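/- Let $m\ge 1$ and $d\ge 0$ be integers. Write points of $\mathbb{R}^{2m}$ as $\vec{x}=(\mathbf{x}_1,\dots,\mathbf{x}_m)$ with $\mathbf{x}_j=(x_j,y_j)\in\mathbb{R}^2$, and let $$Q_m(\vec{x})=\tfrac12\sum_{j=1}^m (x_j^2-y_j^2),\qquad B_m(\vec{x},\vec{x}')=\sum_{j=1}^m (x_jx_j'-y_jy_j').$$ Let $\mathcal{C}=\{\mathbf{x}=(x,y)\in\mathbb{R}^2 : Q_1(\mathbf{x})<0,\ y>0\}$ and $E(z)=2\int_0^z e^{-\pi u^2}\,du$. Let $f$ be a polynomial with complex coefficients in the variables $x_1,y_1,\dots,x_m,y_m$ that is spherical of degree $d$, that is, homogeneous of degree $d$ with $\sum_{j=1}^m\left(\frac{\partial^2}{\partial x_j^2}-\frac{\partial^2}{\partial y_j^2}\right)f=0$. For $\vec{c}_0=(\mathbf{c}_1^{(0)},\dots,\mathbf{c}_m^{(0)})$ and $\vec{c}_1=(\mathbf{c}_1^{(1)},\dots,\mathbf{c}_m^{(1)})$ in $\mathcal{C}^m$ define $$p^{\vec{c}_0,\vec{c}_1}[f](\vec{x})=\sum_{\sigma\in\{0,1\}^m}(-1)^{\sigma_1+\cdots+\sigma_m}\sum_{k=0}^d\frac{(-1)^k}{(4\pi)^k}\sum_{\substack{(k_1,\dots,k_m)\in(\mathbb{Z}_{\ge0})^m\\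 k_1+\cdots+k_m=k}}\left(\prod_{j=1}^m\frac{1}{k_j!}E^{(k_j)}\!\left(\frac{B_1(\mathbf{c}_j^{(\sigma_j)},\mathbf{x}_j)}{\sqrt{-Q_1(\mathbf{c}_j^{(\sigma_j)})}}\right)\right)\left(\prod_{j=1}^m\partial_{j,\mathbf{c}_j^{(\sigma_j)}}^{\,k_j}\right)f(\vec{x}),$$ where $\partial_{j,\mathbf{c}}=\frac{1}{\sqrt{-Q_1(\mathbf{c})}}\left(c_1\frac{\partial}{\partial x_j}+c_2\frac{\partial}{\partial y_j}\right)$ for $\mathbf{c}=(c_1,c_2)$, and $E^{(k)}$ is the $k$-th derivative of $E$. Then for all $\vec{a},\vec{b}\in\mathbb{R}^{2m}$ and all $\tau=u+iv\in\mathbb{C}$ with $v>0$, the series $$\theta_{\vec{a},\vec{b}}(\tau)=v^{-d/2}\sum_{\vec{x}\in\vec{a}+\mathbb{Z}^{2m}}p^{\vec{c}_0,\vec{c}_1}[f](\vec{x}\sqrt{v})\,e^{2\pi i\tau Q_m(\vec{x})}\,e^{2\pi iB_m(\vec{x},\vec{b})}$$ converges absolutely, and $$\theta_{\vec{a},\vec{b}}\left(-\frac1\tau\right)=(-\tau)^{m+d}\,e^{2\pi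 iB_m(\vec{a},\vec{b})}\,\theta_{-\vec{b},\vec{a}}(\tau).$$ -/

import Mathlib

open scoped BigOperators

noncomputable section

namespace IndefiniteTheta

/-- The quadratic form `Q₁(x, y) = (x² - y²) / 2` on `ℝ²`. -/
def Q₁ (x : Fin 2 → ℝ) : ℝ := (1 / 2) * (x 0 ^ 2 - x 1 ^ 2)

/-- The bilinear form associated with `Q₁`. -/
def B₁ (x y : Fin 2 → ℝ) : ℝ := x 0 * y 0 - x 1 * y 1

/-- The component `{Q₁ < 0, y > 0}` of the negative cone of `Q₁`. -/
def negCone : Set (Fin 2 → ℝ) := {c | Q₁ c < 0 ∧ 0 < c 1}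

/-- Points of `ℝ^{2m}`: the coordinate `(j, 0)` is `x_j` and the coordinate `(j, 1)` is `y_j`. -/
abbrev Vec (m : ℕ) : Type := Fin m × Fin 2 → ℝ

/-- Complex polynomials in the `2m` variables `x_j, y_j`. -/
abbrev Poly (m : ℕ) : Type := MvPolynomial (Fin m × Fin 2) ℂ

/-- The `j`-th plane component `(x_j, y_j)` of a point of `ℝ^{2m}`. -/
def Vec.comp {m : ℕ} (x : Vec m) (j : Fin m) : Fin 2 → ℝ := fun i => x (j, i)

/-- The quadratic form of signature `(m, m)`. -/
def Q {m : ℕ} (x : Vec m) : ℝ := (1 / 2) * ∑ j, (x (j, 0) ^ 2 - x (j, 1) ^ 2)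

/-- The bilinear form associated with `Q`. -/
def B {m : ℕ} (x y : Vec m) : ℝ := ∑ j, (x (j, 0) * y (j, 0) - x (j, 1) * y (j, 1))

/-- The Laplace operator of signature `(m, m)` on polynomials. -/
def laplace {m : ℕ} (f : Poly m) : Poly m :=
  ∑ j : Fin m, (MvPolynomial.pderiv (j, 0) (MvPolynomial.pderiv (j, 0) f)
    - MvPolynomial.pderiv (j, 1) (MvPolynomial.pderiv (j, 1) f))

/-- Spherical polynomials of degree `d`: homogeneous of degree `d` and annihilated by the
Laplace operator of signature `(m, m)`. -/
def IsSpherical {m : ℕ} (d : ℕ) (f : Poly m) : Prop :=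
  f.IsHomogeneous d ∧ laplace f = 0

/-- The error function `E(z) = 2 ∫₀ᶻ e^{-π u²} du`. -/
def E (z : ℝ) : ℝ := 2 * ∫ u in (0 : ℝ)..z, Real.exp (-Real.pi * u ^ 2)

/-- The operator `(-Q₁(c))^{-1/2} (c₁ ∂/∂x_j + c₂ ∂/∂y_j)` on polynomials. -/
def dirDeriv {m : ℕ} (c : Fin 2 → ℝ) (j : Fin m) : Module.End ℂ (Poly m) :=
  ((1 / √(-Q₁ c) : ℝ) : ℂ) •
    (((c 0 : ℝ) : ℂ) • (MvPolynomial.pderiv (j, (0 : Fin 2))).toLinearMap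
      + ((c 1 : ℝ) : ℂ) • (MvPolynomial.pderiv (j, (1 : Fin 2))).toLinearMap)

/-- The factor `F`, for the vectors `c j`, the orders `k j` and a point `x`. -/
def F {m : ℕ} (c : Fin m → Fin 2 → ℝ) (k : Fin m → ℕ) (x : Vec m) : ℝ :=
  ∏ j, (1 / ((k j).factorial : ℝ)) *
    iteratedDeriv (k j) E (B₁ (c j) (x.comp j) / √(-Q₁ (c j)))

/-- The factor `G`: apply all the operators `dirDeriv (c j) j ^ k j` (which commute) to `f` and
evaluate at `x`. -/
def G {m : ℕ} (f : Poly m) (c : Fin m → Fin 2 → ℝ) (k : Fin m → ℕ) (x : Vec m) : ℂ :=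
  MvPolynomial.eval (fun i => (x i : ℂ)) ((List.ofFn fun j => dirDeriv (c j) j ^ k j).prod f)

/-- The choice of `c_j^{(σ_j)}` for every `j`. -/
def select {m : ℕ} (c₀ c₁ : Fin m → Fin 2 → ℝ) (σ : Fin m → Fin 2) : Fin m → Fin 2 → ℝ :=
  fun j => if σ j = 0 then c₀ j else c₁ j

/-- The kernel `p^{c₀, c₁}[f]` for a polynomial `f` of degree `d`. The innermost sum runs over all
`κ ∈ (ℤ_{≥0})^m` with `κ_1 + ⋯ + κ_m = k`. -/
def kernel {m : ℕ} (c₀ c₁ : Fin m → Fin 2 → ℝ) (d : ℕ) (f : Poly m) (x : Vec m) : ℂ :=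
  ∑ σ : Fin m → Fin 2, (-1 : ℂ) ^ (∑ j, (σ j : ℕ)) *
    ∑ k ∈ Finset.range (d + 1), ((-1 : ℂ) ^ k / (4 * (Real.pi : ℂ)) ^ k) *
      ∑ κ ∈ Finset.piAntidiag (Finset.univ : Finset (Fin m)) k,
        (F (select c₀ c₁ σ) κ x : ℂ) * G f (select c₀ c₁ σ) κ x

/-- The term `p(x √v) q^{Q(x)} e^{2πi B(x, b)}` of the theta series, where `v = Im τ` and
`q^{Q(x)} = e^{2πi τ Q(x)}`. -/
def thetaTerm {m : ℕ} (c₀ c₁ : Fin m → Fin 2 → ℝ) (d : ℕ) (f : Poly m) (b : Vec m) (τ : ℂ)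
    (x : Vec m) : ℂ :=
  kernel c₀ c₁ d f (√τ.im • x)
    * Complex.exp (2 * (Real.pi : ℂ) * Complex.I * τ * (Q x : ℂ))
    * Complex.exp (2 * (Real.pi : ℂ) * Complex.I * (B x b : ℂ))

/-- The point `a + n` of the shifted lattice `a + ℤ^{2m}`. -/
def shift {m : ℕ} (a : Vec m) (n : Fin m × Fin 2 → ℤ) : Vec m := fun i => a i + (n i : ℝ)

/-- The theta function with characteristics `a, b`; the sum runs over `a + ℤ^{2m}`. -/
def theta {m : ℕ} (c₀ c₁ : Fin m → Fin 2 → ℝ) (d : ℕ) (f : Poly m) (a b : Vec m) (τ : ℂ) : ℂ :=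
  ((τ.im ^ (-(d : ℝ) / 2) : ℝ) : ℂ) *
    ∑' n : Fin m × Fin 2 → ℤ, thetaTerm c₀ c₁ d f b τ (shift a n)

end IndefiniteTheta

end

/-!
Let `Δ = ∑ j, (∂²/∂x_j² - ∂²/∂y_j²)`. The operator `exp(-Δ/8π)` fixes a spherical polynomial `f`,
so every monomial of `f` may be replaced by the product over `j` of the plane polynomials
`exp(-Δ/8π) (x_j^i y_j^k)`. These occupy disjoint blocks of variables, which turns the kernel and
the theta series into finite sums of products over the planes.

In one plane, a vector of the cone is up to scaling `(√2 sinh t, √2 cosh t)`. The differential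
equation of `E` shows that the `t`-derivative of the summand of the kernel attached to this vector
and the monomial `x^i y^k` is `cosh^i t sinh^k t`, up to a constant, times a Hermite function of
degree `n = i + k + 1` in the direction orthogonal to the vector and a Gaussian along it. The kernel
of the plane is thus an integral over `t` of Lorentz boosts of one rapidly decreasing function.
Multiplied by `exp(2πiτ Q₁)`, that function has a Fourier transform of the same shape with `-1/τ` in
place of `τ`. Poisson summation for each `t`, integrated over `t`, gives the transformation of the
theta series of a plane with the factor `|τ| (-τ/|τ|)^n`; over all the planes these factors combine
with the powers of `v` to `(-τ)^(m + d)`.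
-/

noncomputable section

namespace IndefiniteTheta

/-! ### The error function -/

section ErrorFunction

lemma hasDerivAt_E (z : ℝ) : HasDerivAt E (2 * Real.exp (-Real.pi * z ^ 2)) z := by
  have hc : Continuous fun u : ℝ => Real.exp (-Real.pi * u ^ 2) := by fun_prop
  exact ((hc.integral_hasStrictDerivAt 0 z).hasDerivAt).const_mul 2

lemma deriv_E : deriv E = fun z => 2 * Real.exp (-Real.pi * z ^ 2) :=
  funext fun z => (hasDerivAt_E z).deriv

lemma contDiff_E : ContDiff ℝ (⊤ : ℕ∞) E := by
  rw [contDiff_infty_iff_deriv, deriv_E]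
  exact ⟨fun z => (hasDerivAt_E z).differentiableAt, by fun_prop⟩

lemma hasDerivAt_iteratedDeriv_E (k : ℕ) (z : ℝ) :
    HasDerivAt (iteratedDeriv k E) (iteratedDeriv (k + 1) E z) z := by
  rw [iteratedDeriv_succ]
  exact (contDiff_E.differentiable_iteratedDeriv k
    (by exact_mod_cast ENat.natCast_lt_top k) z).hasDerivAt

lemma iteratedDeriv_two_E (z : ℝ) :
    iteratedDeriv 2 E z = -2 * Real.pi * (z * deriv E z) := by
  have h : HasDerivAt (deriv E) (2 * (Real.exp (-Real.pi * z ^ 2) * (-Real.pi * (2 * z)))) z := by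
    rw [deriv_E]
    simpa using (((hasDerivAt_pow 2 z).const_mul (-Real.pi)).exp).const_mul 2
  rw [iteratedDeriv_succ, iteratedDeriv_one, h.deriv, deriv_E]
  ring

lemma iteratedDeriv_E_add_two (k : ℕ) (z : ℝ) :
    iteratedDeriv (k + 2) E z =
      -2 * Real.pi * (z * iteratedDeriv (k + 1) E z + k * iteratedDeriv k E z) := by
  induction k generalizing z with
  | zero => simpa using iteratedDeriv_two_E z
  | succ k ih =>
    have h : HasDerivAt (iteratedDeriv (k + 2) E)
        (-2 * Real.pi * ((1 * iteratedDeriv (k + 1) E z + z * iteratedDeriv (k + 2) E z)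
          + k * iteratedDeriv (k + 1) E z)) z := by
      refine HasDerivAt.congr_of_eventuallyEq ?_ (.of_forall ih)
      exact (((hasDerivAt_id' z).fun_mul (hasDerivAt_iteratedDeriv_E (k + 1) z)).fun_add
        ((hasDerivAt_iteratedDeriv_E k z).const_mul (k : ℝ))).const_mul _
    rw [(hasDerivAt_iteratedDeriv_E (k + 2) z).unique h]
    push_cast
    ring

end ErrorFunction

/-! ### Restriction of polynomials to lines -/

section LineRestriction

open MvPolynomial

variable {σ R : Type*}

/-- The linear functional on `R[w]` with value `e k` at `w ^ k`. -/
def coeffFunctional [CommSemiring R] (e : ℕ → R) : Polynomial R →ₗ[R] R :=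
  Polynomial.lsum fun k => LinearMap.mulRight R (e k)

section CommSemiring

variable [CommSemiring R]

lemma coeffFunctional_eq_sum_range (e : ℕ → R) {p : Polynomial R} {N : ℕ} (hN : p.natDegree < N) :
    coeffFunctional e p = ∑ k ∈ Finset.range N, p.coeff k * e k :=
  p.sum_over_range' (f := fun k a => a * e k) (fun _ => zero_mul _) N hN

lemma coeffFunctional_monomial (e : ℕ → R) (k : ℕ) (a : R) :
    coeffFunctional e (Polynomial.monomial k a) = a * e k :=
  Polynomial.sum_monomial_index a _ (zero_mul _)

lemma coeffFunctional_C (e : ℕ → R) (a : R) : coeffFunctional e (Polynomial.C a) = a * e 0 :=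
  coeffFunctional_monomial e 0 a

lemma coeffFunctional_C_mul (e : ℕ → R) (a : R) (p : Polynomial R) :
    coeffFunctional e (Polynomial.C a * p) = a * coeffFunctional e p := by
  rw [← Polynomial.smul_eq_C_mul, map_smul, smul_eq_mul]

lemma coeffFunctional_X_mul (e : ℕ → R) (p : Polynomial R) :
    coeffFunctional e (Polynomial.X * p) = coeffFunctional (fun k => e (k + 1)) p := by
  induction p using Polynomial.induction_on' with
  | add p q hp hq => rw [mul_add, map_add, map_add, hp, hq]
  | monomial n a =>
    rw [Polynomial.X_mul_monomial, coeffFunctional_monomial, coeffFunctional_monomial]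

lemma coeffFunctional_smul (a : R) (e : ℕ → R) (p : Polynomial R) :
    coeffFunctional (a • e) p = a * coeffFunctional e p := by
  induction p using Polynomial.induction_on' with
  | add p q hp hq => rw [map_add, map_add, hp, hq, mul_add]
  | monomial n b =>
    rw [coeffFunctional_monomial, coeffFunctional_monomial, Pi.smul_apply, smul_eq_mul,
      mul_left_comm]

lemma coeffFunctional_eq_zero_of_recurrence {R : Type*} [CommRing R] {e : ℕ → R} {α β γ : R}
    (he : ∀ n, α * e n + β * e (n + 1) + γ * n * e (n - 1) = 0) (p : Polynomial R) :
    coeffFunctional e ((Polynomial.C α + Polynomial.C β * Polynomial.X) * p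
      + Polynomial.C γ * Polynomial.derivative p) = 0 := by
  induction p using Polynomial.induction_on' with
  | add p q hp hq =>
    rw [Polynomial.derivative_add, mul_add, mul_add, add_add_add_comm, map_add, hp, hq, add_zero]
  | monomial n a =>
    rw [add_mul, map_add, map_add, mul_assoc, coeffFunctional_C_mul, coeffFunctional_C_mul,
      coeffFunctional_C_mul, Polynomial.X_mul_monomial, Polynomial.derivative_monomial,
      coeffFunctional_monomial, coeffFunctional_monomial, coeffFunctional_monomial]
    linear_combination a * he n

/-- The polynomial `w ↦ g (x + w u)` in one variable. -/
def lineRestrict (x u : σ → R) : MvPolynomial σ R →ₐ[R] Polynomial R :=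
  aeval fun i => Polynomial.C (x i) + Polynomial.C (u i) * Polynomial.X

lemma lineRestrict_X (x u : σ → R) (i : σ) :
    lineRestrict x u (X i) = Polynomial.C (x i) + Polynomial.C (u i) * Polynomial.X :=
  aeval_X _ _

lemma lineRestrict_C (x u : σ → R) (a : R) : lineRestrict x u (C a) = Polynomial.C a :=
  aeval_C _ _

lemma coeff_zero_lineRestrict (x u : σ → R) (g : MvPolynomial σ R) :
    (lineRestrict x u g).coeff 0 = eval x g := by
  induction g using MvPolynomial.induction_on with
  | C a => simp
  | add p q hp hq => rw [map_add, Polynomial.coeff_add, hp, hq, map_add]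
  | mul_X p i hp => rw [map_mul, Polynomial.mul_coeff_zero, hp, map_mul, lineRestrict_X]; simp

lemma natDegree_lineRestrict_le (x u : σ → R) (g : MvPolynomial σ R) :
    (lineRestrict x u g).natDegree ≤ g.totalDegree := by
  rw [lineRestrict, aeval_def, eval₂_eq]
  refine Polynomial.natDegree_sum_le_of_forall_le _ _ fun s hs =>
    (Polynomial.natDegree_C_mul_le _ _).trans ((Polynomial.natDegree_prod_le _ _).trans ?_)
  refine le_trans (Finset.sum_le_sum fun i _ => ?_) (le_totalDegree hs)
  have h : (Polynomial.C (x i) + Polynomial.C (u i) * Polynomial.X).natDegree ≤ 1 := by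
    compute_degree
  simpa using Polynomial.natDegree_pow_le_of_le (s i) h

/-- The derivation of `R[X_i : i ∈ σ]` in the direction `u`. -/
def lineDerivation (u : σ → R) : Derivation R (MvPolynomial σ R) (MvPolynomial σ R) :=
  mkDerivation R fun i => C (u i)

lemma lineDerivation_X (u : σ → R) (i : σ) : lineDerivation u (X i) = C (u i) :=
  mkDerivation_X _ _ _

lemma lineDerivation_eq_sum [Fintype σ] (u : σ → R) (g : MvPolynomial σ R) :
    lineDerivation u g = ∑ i, C (u i) * pderiv i g := by
  classical
  have h : lineDerivation u = ∑ i, (C (u i) : MvPolynomial σ R) • pderiv i := by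
    refine derivation_ext fun j => ?_
    rw [← Derivation.coeFnAddMonoidHom_apply, ← Derivation.coeFnAddMonoidHom_apply, map_sum]
    simp [lineDerivation_X, pderiv_X, Pi.single_apply]
  rw [h, ← Derivation.coeFnAddMonoidHom_apply, map_sum, Finset.sum_apply]
  rfl

lemma lineRestrict_lineDerivation (x u : σ → R) (g : MvPolynomial σ R) :
    lineRestrict x u (lineDerivation u g) = Polynomial.derivative (lineRestrict x u g) := by
  induction g using MvPolynomial.induction_on with
  | C a => simp
  | add p q hp hq => rw [map_add, map_add, hp, hq, map_add, map_add]
  | mul_X p i hp =>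
    rw [Derivation.leibniz, lineDerivation_X, smul_eq_mul, smul_eq_mul, map_add, map_mul, map_mul,
      map_mul, hp, Polynomial.derivative_mul, lineRestrict_X, lineRestrict_C]
    simp only [Polynomial.derivative_add, Polynomial.derivative_C, Polynomial.derivative_mul,
      Polynomial.derivative_X]
    ring

lemma lineRestrict_lineDerivation_pow (x u : σ → R) (k : ℕ) (g : MvPolynomial σ R) :
    lineRestrict x u (((lineDerivation u).toLinearMap ^ k) g) =
      Polynomial.derivative^[k] (lineRestrict x u g) := by
  induction k with
  | zero => rfl
  | succ k ih =>
    rw [pow_succ', Module.End.mul_apply, Derivation.coeFn_coe, lineRestrict_lineDerivation, ih,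
      Function.iterate_succ_apply']

lemma eval_lineDerivation_pow (x u : σ → R) (k : ℕ) (g : MvPolynomial σ R) :
    eval x (((lineDerivation u).toLinearMap ^ k) g) =
      k.factorial * (lineRestrict x u g).coeff k := by
  rw [← coeff_zero_lineRestrict x u, lineRestrict_lineDerivation_pow,
    Polynomial.coeff_iterate_derivative, zero_add, Nat.descFactorial_self, nsmul_eq_mul]

end CommSemiring

end LineRestriction

/-! ### Creation operators and Hermite polynomials -/

section Creation

open MvPolynomial

variable {σ R : Type*} [CommRing R]

/-- The creation operator `g ↦ X_i g - w_i ∂_i g` with weights `w`. -/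
def create (w : σ → R) (i : σ) : Module.End R (MvPolynomial σ R) :=
  LinearMap.mulLeft R (X i) - w i • (pderiv i).toLinearMap

lemma create_apply (w : σ → R) (i : σ) (g : MvPolynomial σ R) :
    create w i g = X i * g - C (w i) * pderiv i g := by
  simp [create, smul_eq_C_mul]

lemma pderiv_comm (i j : σ) (g : MvPolynomial σ R) :
    pderiv i (pderiv j g) = pderiv j (pderiv i g) := by
  classical
  have h : ⁅(pderiv i : Derivation R (MvPolynomial σ R) (MvPolynomial σ R)),
      (pderiv j : Derivation R (MvPolynomial σ R) (MvPolynomial σ R))⁆ = 0 := by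
    refine derivation_ext fun k => ?_
    rw [Derivation.commutator_apply, pderiv_X, pderiv_X]
    by_cases hj : j = k <;> by_cases hi : i = k <;> simp [hj, hi]
  have hg := congrArg (fun D => D g) h
  rw [Derivation.commutator_apply] at hg
  exact sub_eq_zero.mp hg

lemma create_comm (w : σ → R) (i j : σ) : Commute (create w i) (create w j) := by
  classical
  refine LinearMap.ext fun g => ?_
  rcases eq_or_ne i j with rfl | hij
  · rfl
  simp only [Module.End.mul_apply, create_apply, map_sub, Derivation.leibniz, pderiv_X, pderiv_C,
    smul_eq_mul, Pi.single_apply, if_neg hij, if_neg hij.symm]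
  rw [pderiv_comm i j g]
  ring

lemma totalDegree_pderiv_le (i : σ) (g : MvPolynomial σ R) :
    (pderiv i g).totalDegree ≤ g.totalDegree := by
  conv_lhs => rw [g.as_sum, map_sum]
  refine totalDegree_finsetSum_le fun s hs => ?_
  rw [pderiv_monomial]
  exact (totalDegree_monomial_le _ _).trans
    ((Finsupp.degree_mono tsub_le_self).trans (le_totalDegree hs))

lemma totalDegree_create_le [Nontrivial R] (w : σ → R) (i : σ) (g : MvPolynomial σ R) :
    (create w i g).totalDegree ≤ g.totalDegree + 1 := by
  rw [create_apply]
  refine (totalDegree_sub _ _).trans (max_le ((totalDegree_mul _ _).trans ?_)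
    ((totalDegree_mul _ _).trans ?_))
  · rw [totalDegree_X, add_comm]
  · rw [totalDegree_C, zero_add]
    exact (totalDegree_pderiv_le i g).trans (Nat.le_succ _)

end Creation

section Plane

open MvPolynomial

/-- The weights `(1/4π, -1/4π)`, for which the creation operators of the plane are conjugate to the
multiplication operators under `exp(-Δ/8π)`, where `Δ = ∂²/∂x² - ∂²/∂y²`. -/
def planeWeight : Fin 2 → ℂ := ![1 / (4 * Real.pi), -1 / (4 * Real.pi)]

/-- The polynomial `exp(-Δ/8π) (x^i y^k)`, where `Δ = ∂²/∂x² - ∂²/∂y²`. -/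
def hermitePlane (i k : ℕ) : MvPolynomial (Fin 2) ℂ :=
  (create planeWeight 0 ^ i) ((create planeWeight 1 ^ k) 1)

lemma hermitePlane_succ_left (i k : ℕ) :
    hermitePlane (i + 1) k = create planeWeight 0 (hermitePlane i k) := by
  rw [hermitePlane, hermitePlane, pow_succ', Module.End.mul_apply]

lemma hermitePlane_succ_right (i k : ℕ) :
    hermitePlane i (k + 1) = create planeWeight 1 (hermitePlane i k) := by
  have h := LinearMap.congr_fun ((create_comm planeWeight 1 0).pow_right i)
    ((create planeWeight 1 ^ k) 1)
  rw [Module.End.mul_apply, Module.End.mul_apply] at h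
  rw [hermitePlane, hermitePlane, h, pow_succ', Module.End.mul_apply]

lemma totalDegree_hermitePlane_le (i k : ℕ) : (hermitePlane i k).totalDegree ≤ i + k := by
  induction i with
  | zero =>
    induction k with
    | zero => simp [hermitePlane]
    | succ k ih =>
      rw [hermitePlane_succ_right]
      exact (totalDegree_create_le _ _ _).trans (by omega)
  | succ i ih =>
    rw [hermitePlane_succ_left]
    exact (totalDegree_create_le _ _ _).trans (by omega)

/-- The Hermite polynomial `exp(-(d/du)²/8π) u^n`. -/
def hermitePoly : ℕ → Polynomial ℂ
  | 0 => 1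
  | n + 1 => Polynomial.X * hermitePoly n
      - Polynomial.C (1 / (4 * Real.pi : ℂ)) * Polynomial.derivative (hermitePoly n)

/-- The linear form `B₁(v, ·)` as a polynomial. -/
def linearForm (v : Fin 2 → ℝ) : MvPolynomial (Fin 2) ℂ := C (v 0 : ℂ) * X 0 - C (v 1 : ℂ) * X 1

/-- The derivation of the polynomials on the plane in the direction `v`. -/
def planeDeriv (v : Fin 2 → ℝ) : Derivation ℂ (MvPolynomial (Fin 2) ℂ) (MvPolynomial (Fin 2) ℂ) :=
  lineDerivation fun i => (v i : ℂ)

lemma planeDeriv_apply (v : Fin 2 → ℝ) (g : MvPolynomial (Fin 2) ℂ) :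
    planeDeriv v g = C (v 0 : ℂ) * pderiv 0 g + C (v 1 : ℂ) * pderiv 1 g := by
  rw [planeDeriv, lineDerivation_eq_sum, Fin.sum_univ_two]

lemma planeDeriv_X (v : Fin 2 → ℝ) (i : Fin 2) : planeDeriv v (X i) = C (v i : ℂ) :=
  lineDerivation_X _ _

lemma planeDeriv_linearForm (v u : Fin 2 → ℝ) :
    planeDeriv v (linearForm u) = C (B₁ u v : ℂ) := by
  simp [linearForm, B₁, planeDeriv_X, Derivation.leibniz]

/-- The creation operator attached to the linear form `B₁(v, ·)`. -/
def createAlong (v : Fin 2 → ℝ) : Module.End ℂ (MvPolynomial (Fin 2) ℂ) :=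
  (v 0 : ℂ) • create planeWeight 0 - (v 1 : ℂ) • create planeWeight 1

lemma createAlong_apply (v : Fin 2 → ℝ) (g : MvPolynomial (Fin 2) ℂ) :
    createAlong v g = linearForm v * g - C (1 / (4 * Real.pi : ℂ)) * planeDeriv v g := by
  simp only [createAlong, planeWeight, linearForm, LinearMap.sub_apply, LinearMap.smul_apply,
    create_apply, planeDeriv_apply, smul_eq_C_mul, Matrix.cons_val_zero, Matrix.cons_val_one,
    neg_div, C_neg]
  ring

lemma create_zero_eq_createAlong : create planeWeight 0 = createAlong ![1, 0] := by
  simp [createAlong]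

lemma create_one_eq_createAlong : create planeWeight 1 = createAlong ![0, -1] := by
  simp only [createAlong, Matrix.cons_val_zero, Matrix.cons_val_one, Complex.ofReal_zero,
    Complex.ofReal_neg, Complex.ofReal_one]
  module

lemma createAlong_comm (v u : Fin 2 → ℝ) : Commute (createAlong v) (createAlong u) := by
  have h (a b : ℂ) (i j : Fin 2) : Commute (a • create planeWeight i) (b • create planeWeight j) :=
    ((create_comm planeWeight i j).smul_left a).smul_right b
  unfold createAlong
  exact ((h _ _ 0 0).sub_right (h _ _ 0 1)).sub_left ((h _ _ 1 0).sub_right (h _ _ 1 1))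

lemma createAlong_pow_apply_comm (v u : Fin 2 → ℝ) (i k : ℕ) (g : MvPolynomial (Fin 2) ℂ) :
    (createAlong v ^ i) ((createAlong u ^ k) g) = (createAlong u ^ k) ((createAlong v ^ i) g) :=
  LinearMap.congr_fun ((createAlong_comm v u).pow_pow i k).eq g

lemma createAlong_mul_X (v : Fin 2 → ℝ) (g : MvPolynomial (Fin 2) ℂ) (i : Fin 2) :
    createAlong v (g * X i) = X i * createAlong v g - C ((v i : ℂ) / (4 * Real.pi)) * g := by
  rw [createAlong_apply, createAlong_apply, Derivation.leibniz, planeDeriv_X, smul_eq_mul,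
    smul_eq_mul, div_eq_mul_one_div (v i : ℂ), C_mul]
  ring

lemma createAlong_aeval_linearForm {v : Fin 2 → ℝ} (hv : B₁ v v = 1) (q : Polynomial ℂ) :
    createAlong v (Polynomial.aeval (linearForm v) q) = Polynomial.aeval (linearForm v)
      (Polynomial.X * q - Polynomial.C (1 / (4 * Real.pi : ℂ)) * Polynomial.derivative q) := by
  rw [createAlong_apply, Derivation.map_aeval, planeDeriv_linearForm, hv, map_sub, map_mul, map_mul,
    Polynomial.aeval_X, Polynomial.aeval_C, Complex.ofReal_one, C_1, smul_eq_mul, mul_one,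
    algebraMap_eq]

lemma createAlong_pow_one {v : Fin 2 → ℝ} (hv : B₁ v v = 1) (n : ℕ) :
    (createAlong v ^ n) 1 = Polynomial.aeval (linearForm v) (hermitePoly n) := by
  induction n with
  | zero => simp [hermitePoly]
  | succ n ih =>
    rw [pow_succ', Module.End.mul_apply, ih, createAlong_aeval_linearForm hv, hermitePoly]

/-- The restriction of the polynomial `g` to the line through `x` in the direction `c`. -/
def planeRestrict (x c : Fin 2 → ℝ) : MvPolynomial (Fin 2) ℂ →ₐ[ℂ] Polynomial ℂ :=
  lineRestrict (fun i => (x i : ℂ)) fun i => (c i : ℂ)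

lemma planeRestrict_X (x c : Fin 2 → ℝ) (i : Fin 2) :
    planeRestrict x c (X i) = Polynomial.C (x i : ℂ) + Polynomial.C (c i : ℂ) * Polynomial.X :=
  lineRestrict_X _ _ _

lemma planeRestrict_C (x c : Fin 2 → ℝ) (a : ℂ) : planeRestrict x c (C a) = Polynomial.C a :=
  lineRestrict_C _ _ _

lemma planeRestrict_linearForm (x c v : Fin 2 → ℝ) :
    planeRestrict x c (linearForm v) =
      Polynomial.C (B₁ v x : ℂ) + Polynomial.C (B₁ v c : ℂ) * Polynomial.X := by
  simp only [linearForm, B₁, map_sub, map_mul, planeRestrict_X, planeRestrict_C,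
    Complex.ofReal_sub, Complex.ofReal_mul]
  ring

/-- The values `(-1/4π)^k E^{(k + r)}(z)` at the monomials of the functional `coneOp`. -/
def coneWeight (r : ℕ) (z : ℝ) (k : ℕ) : ℂ :=
  (-1 / (4 * Real.pi : ℂ)) ^ k * (iteratedDeriv (k + r) E z : ℝ)

/-- The functional `g ↦ ∑ k, (-1/4π)^k / k! * E^{(k + r)}(B₁(c, x)) (∂_c^k g)(x)`. For `r = 0` and
`Q₁(c) = -1` it is the summand of the kernel attached to one plane. -/
def coneOp (r : ℕ) (c x : Fin 2 → ℝ) : MvPolynomial (Fin 2) ℂ →ₗ[ℂ] ℂ :=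
  coeffFunctional (coneWeight r (B₁ c x)) ∘ₗ (planeRestrict x c).toLinearMap

lemma coneOp_apply (r : ℕ) (c x : Fin 2 → ℝ) (g : MvPolynomial (Fin 2) ℂ) :
    coneOp r c x g = coeffFunctional (coneWeight r (B₁ c x)) (planeRestrict x c g) := rfl

lemma coneWeight_zero (r : ℕ) (z : ℝ) : coneWeight r z 0 = iteratedDeriv r E z := by
  simp [coneWeight]

lemma coneWeight_succ (r : ℕ) (z : ℝ) (k : ℕ) :
    coneWeight r z (k + 1) = -1 / (4 * Real.pi) * coneWeight (r + 1) z k := by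
  rw [coneWeight, coneWeight, pow_succ', mul_assoc, add_right_comm, add_assoc]

lemma coneOp_C (r : ℕ) (c x : Fin 2 → ℝ) (a : ℂ) :
    coneOp r c x (C a) = a * iteratedDeriv r E (B₁ c x) := by
  rw [coneOp_apply, planeRestrict_C, coeffFunctional_C, coneWeight_zero]

lemma coneOp_C_mul (r : ℕ) (c x : Fin 2 → ℝ) (a : ℂ) (g : MvPolynomial (Fin 2) ℂ) :
    coneOp r c x (C a * g) = a * coneOp r c x g := by
  rw [← smul_eq_C_mul, map_smul, smul_eq_mul]

lemma coneOp_X_mul (r : ℕ) (c x : Fin 2 → ℝ) (i : Fin 2) (g : MvPolynomial (Fin 2) ℂ) :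
    coneOp r c x (X i * g) =
      x i * coneOp r c x g - c i / (4 * Real.pi) * coneOp (r + 1) c x g := by
  have h : (fun k => coneWeight r (B₁ c x) (k + 1)) =
      (-1 / (4 * Real.pi : ℂ)) • coneWeight (r + 1) (B₁ c x) :=
    funext fun k => coneWeight_succ _ _ _
  rw [coneOp_apply, map_mul, planeRestrict_X, add_mul, map_add, coeffFunctional_C_mul, mul_assoc,
    coeffFunctional_C_mul, coeffFunctional_X_mul, h, coeffFunctional_smul, ← coneOp_apply,
    ← coneOp_apply]
  ring

lemma coneOp_linearForm_mul (r : ℕ) (c x v : Fin 2 → ℝ) (g : MvPolynomial (Fin 2) ℂ) :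
    coneOp r c x (linearForm v * g) =
      B₁ v x * coneOp r c x g - B₁ v c / (4 * Real.pi) * coneOp (r + 1) c x g := by
  rw [linearForm, sub_mul, mul_assoc, mul_assoc, map_sub, coneOp_C_mul, coneOp_C_mul, coneOp_X_mul,
    coneOp_X_mul, B₁, B₁]
  push_cast
  ring

lemma coneOp_aeval_linearForm (r : ℕ) {c v : Fin 2 → ℝ} (hv : B₁ v c = 0) (x : Fin 2 → ℝ)
    (q : Polynomial ℂ) :
    coneOp r c x (Polynomial.aeval (linearForm v) q) =
      q.eval (B₁ v x : ℂ) * iteratedDeriv r E (B₁ c x) := by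
  rw [coneOp_apply, ← Polynomial.aeval_algHom_apply, planeRestrict_linearForm, hv,
    Complex.ofReal_zero, map_zero, zero_mul, add_zero, ← Polynomial.algebraMap_eq,
    Polynomial.aeval_algebraMap_apply, Polynomial.algebraMap_eq, coeffFunctional_C,
    coneWeight_zero, Polynomial.coe_aeval_eq_eval]

/-! ### The derivative of the cone functional along the hyperbola `Q₁ = -1` -/

lemma coneOp_one_createAlong_self {c : Fin 2 → ℝ} (hc : B₁ c c = -2) (x : Fin 2 → ℝ)
    (g : MvPolynomial (Fin 2) ℂ) : coneOp 1 c x (createAlong c g) = 0 := by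
  have hpi : (Real.pi : ℂ) ≠ 0 := Complex.ofReal_ne_zero.mpr Real.pi_ne_zero
  have hline : planeRestrict x c (createAlong c g) =
      (Polynomial.C (B₁ c x : ℂ) + Polynomial.C (-2) * Polynomial.X) * planeRestrict x c g
        + Polynomial.C (-1 / (4 * Real.pi : ℂ)) * Polynomial.derivative (planeRestrict x c g) := by
    rw [createAlong_apply, map_sub, map_mul, map_mul, planeRestrict_C, planeRestrict_linearForm, hc,
      planeDeriv, planeRestrict, lineRestrict_lineDerivation, neg_div,
      Polynomial.C_neg (a := 1 / (4 * (Real.pi : ℂ))), neg_mul, ← sub_eq_add_neg,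
      Complex.ofReal_neg, Complex.ofReal_ofNat]
  rw [coneOp_apply, hline]
  refine coeffFunctional_eq_zero_of_recurrence (fun n => ?_) _
  have ode : ((iteratedDeriv (n + 2) E (B₁ c x) : ℝ) : ℂ) = -2 * Real.pi *
      (B₁ c x * (iteratedDeriv (n + 1) E (B₁ c x) : ℝ)
        + n * (iteratedDeriv n E (B₁ c x) : ℝ)) := by
    exact_mod_cast iteratedDeriv_E_add_two n (B₁ c x)
  simp only [coneWeight]
  rw [show n + 1 + 1 = n + 2 from rfl, ode, pow_succ]
  rcases n with _ | n
  · push_cast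
    field_simp
    ring
  · rw [Nat.add_sub_cancel, pow_succ]
    field_simp
    ring

lemma hasDerivAt_coneOp {c : ℝ → Fin 2 → ℝ} {v : Fin 2 → ℝ} {t : ℝ} (hc : HasDerivAt c v t)
    (hv : B₁ v (c t) = 0) (r : ℕ) (x : Fin 2 → ℝ) (g : MvPolynomial (Fin 2) ℂ) :
    HasDerivAt (fun s => coneOp r (c s) x g) (coneOp (r + 1) (c t) x (createAlong v g)) t := by
  have hci (i : Fin 2) : HasDerivAt (fun s => c s i) (v i) t := hasDerivAt_pi.mp hc i
  induction g using MvPolynomial.induction_on generalizing r with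
  | C a =>
    have hB : HasDerivAt (fun s => B₁ (c s) x) (B₁ v x) t :=
      ((hci 0).mul_const _).sub ((hci 1).mul_const _)
    have hE := (((hasDerivAt_iteratedDeriv_E r _).comp t hB).ofReal_comp).const_mul a
    simp only [coneOp_C]
    refine hE.congr_deriv ?_
    rw [createAlong_apply, ← algebraMap_eq, Derivation.map_algebraMap, mul_zero, sub_zero,
      algebraMap_eq, coneOp_linearForm_mul, hv, coneOp_C]
    push_cast
    ring
  | add p q hp hq =>
    simp only [map_add]
    exact (hp r).add (hq r)
  | mul_X p i hp =>
    have hX : (fun s => coneOp r (c s) x (p * X i)) = fun s => (x i : ℂ) * coneOp r (c s) x p -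
        (c s i : ℂ) / (4 * Real.pi) * coneOp (r + 1) (c s) x p :=
      funext fun s => by rw [mul_comm, coneOp_X_mul]
    rw [hX]
    refine (((hp r).const_mul (x i : ℂ)).sub
      ((((hci i).ofReal_comp).div_const (4 * Real.pi : ℂ)).mul (hp (r + 1)))).congr_deriv ?_
    rw [createAlong_mul_X, map_sub, coneOp_C_mul, coneOp_X_mul]
    ring

/-- The vector in the negative cone with `Q₁ = -1` and hyperbolic angle `t`. -/
def coneVec (t : ℝ) : Fin 2 → ℝ := ![√2 * Real.sinh t, √2 * Real.cosh t]

/-- The unit vector orthogonal to `coneVec t`. -/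
def tangentVec (t : ℝ) : Fin 2 → ℝ := ![Real.cosh t, Real.sinh t]

lemma B₁_smul_left (a : ℝ) (x y : Fin 2 → ℝ) : B₁ (a • x) y = a * B₁ x y := by
  simp only [B₁, Pi.smul_apply, smul_eq_mul]
  ring

lemma B₁_coneVec_self (t : ℝ) : B₁ (coneVec t) (coneVec t) = -2 := by
  simp only [B₁, coneVec, Matrix.cons_val_zero, Matrix.cons_val_one]
  linear_combination (-2) * Real.cosh_sq_sub_sinh_sq t
    + (Real.sinh t ^ 2 - Real.cosh t ^ 2) * Real.sq_sqrt (zero_le_two : (0 : ℝ) ≤ 2)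

lemma B₁_tangentVec_self (t : ℝ) : B₁ (tangentVec t) (tangentVec t) = 1 := by
  simp [B₁, tangentVec, ← sq]

lemma B₁_tangentVec_coneVec (t : ℝ) : B₁ (tangentVec t) (coneVec t) = 0 := by
  simp only [B₁, coneVec, tangentVec, Matrix.cons_val_zero, Matrix.cons_val_one]
  ring

lemma hasDerivAt_coneVec (t : ℝ) : HasDerivAt coneVec (√2 • tangentVec t) t := by
  refine hasDerivAt_pi.mpr fun i => ?_
  fin_cases i
  · exact (Real.hasDerivAt_sinh t).const_mul √2
  · exact (Real.hasDerivAt_cosh t).const_mul √2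

lemma createAlong_smul (a : ℝ) (v : Fin 2 → ℝ) : createAlong (a • v) = (a : ℂ) • createAlong v := by
  simp only [createAlong, Pi.smul_apply, smul_eq_mul, Complex.ofReal_mul, smul_sub, mul_smul]

lemma createAlong_eq_add (v : Fin 2 → ℝ) (t : ℝ) :
    createAlong v = (B₁ v (tangentVec t) : ℂ) • createAlong (tangentVec t)
      + (-B₁ v (coneVec t) / 2 : ℂ) • createAlong (coneVec t) := by
  have h2 : (√2 : ℂ) ^ 2 = 2 := by
    rw [← Complex.ofReal_pow, Real.sq_sqrt zero_le_two, Complex.ofReal_ofNat]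
  have h1 : (Real.cosh t : ℂ) ^ 2 - (Real.sinh t : ℂ) ^ 2 = 1 := by
    exact_mod_cast Real.cosh_sq_sub_sinh_sq t
  simp only [createAlong, B₁, tangentVec, coneVec, Matrix.cons_val_zero, Matrix.cons_val_one,
    Complex.ofReal_mul, Complex.ofReal_sub]
  generalize Real.cosh t = p, Real.sinh t = q at h1 ⊢
  match_scalars
  · linear_combination -(v 0 : ℂ) * h1 + (v 0 * (q : ℂ) ^ 2 - v 1 * p * q) / 2 * h2
  · linear_combination (v 1 : ℂ) * h1 + (v 1 * (p : ℂ) ^ 2 - v 0 * p * q) / 2 * h2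

lemma coneOp_one_createAlong (v : Fin 2 → ℝ) (t : ℝ) (x : Fin 2 → ℝ)
    (g : MvPolynomial (Fin 2) ℂ) : coneOp 1 (coneVec t) x (createAlong v g) =
      B₁ v (tangentVec t) * coneOp 1 (coneVec t) x (createAlong (tangentVec t) g) := by
  rw [createAlong_eq_add v t, LinearMap.add_apply, map_add, LinearMap.smul_apply,
    LinearMap.smul_apply, map_smul, map_smul, coneOp_one_createAlong_self (B₁_coneVec_self t),
    smul_zero, add_zero, smul_eq_mul]

lemma coneOp_one_createAlong_pow (v : Fin 2 → ℝ) (t : ℝ) (x : Fin 2 → ℝ) (n : ℕ)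
    (g : MvPolynomial (Fin 2) ℂ) : coneOp 1 (coneVec t) x ((createAlong v ^ n) g) =
      B₁ v (tangentVec t) ^ n * coneOp 1 (coneVec t) x ((createAlong (tangentVec t) ^ n) g) := by
  induction n generalizing g with
  | zero => simp
  | succ n ih =>
    have hcomm : createAlong (tangentVec t) ((createAlong v ^ n) g) =
        (createAlong v ^ n) (createAlong (tangentVec t) g) := by
      simpa only [pow_one] using createAlong_pow_apply_comm (tangentVec t) v 1 n g
    rw [pow_succ', Module.End.mul_apply, coneOp_one_createAlong, hcomm, ih,
      pow_succ (createAlong (tangentVec t)), Module.End.mul_apply]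
    ring

lemma coneOp_one_tangentVec_hermitePlane (i k : ℕ) (t : ℝ) (x : Fin 2 → ℝ) :
    coneOp 1 (coneVec t) x (createAlong (tangentVec t) (hermitePlane i k)) =
      (Real.cosh t ^ i * Real.sinh t ^ k : ℝ) *
        ((hermitePoly (i + k + 1)).eval (B₁ (tangentVec t) x : ℂ)
          * deriv E (B₁ (coneVec t) x)) := by
  have hcosh : B₁ ![1, 0] (tangentVec t) = Real.cosh t := by simp [B₁, tangentVec]
  have hsinh : B₁ ![0, -1] (tangentVec t) = Real.sinh t := by simp [B₁, tangentVec]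
  calc coneOp 1 (coneVec t) x (createAlong (tangentVec t) (hermitePlane i k))
    _ = coneOp 1 (coneVec t) x ((createAlong ![1, 0] ^ i) ((createAlong ![0, -1] ^ k)
        (createAlong (tangentVec t) 1))) := by
      rw [← pow_one (createAlong (tangentVec t)),
        ← createAlong_pow_apply_comm (tangentVec t) ![0, -1] 1 k 1,
        ← createAlong_pow_apply_comm (tangentVec t) ![1, 0] 1 i, hermitePlane,
        create_zero_eq_createAlong, create_one_eq_createAlong]
    _ = Real.cosh t ^ i * (Real.sinh t ^ k * coneOp 1 (coneVec t) x
        ((createAlong (tangentVec t) ^ k) ((createAlong (tangentVec t) ^ (i + 1)) 1))) := by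
      rw [coneOp_one_createAlong_pow, hcosh, createAlong_pow_apply_comm (tangentVec t) ![0, -1] i k,
        coneOp_one_createAlong_pow, hsinh, pow_succ (createAlong (tangentVec t)) i,
        Module.End.mul_apply]
    _ = _ := by
      rw [← Module.End.mul_apply, ← pow_add, createAlong_pow_one (B₁_tangentVec_self t),
        coneOp_aeval_linearForm 1 (B₁_tangentVec_coneVec t), iteratedDeriv_one, ← mul_assoc,
        ← add_assoc, add_comm k i, Complex.ofReal_mul, Complex.ofReal_pow, Complex.ofReal_pow]

lemma hasDerivAt_coneOp_hermitePlane (i k : ℕ) (t : ℝ) (x : Fin 2 → ℝ) :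
    HasDerivAt (fun s => coneOp 0 (coneVec s) x (hermitePlane i k))
      ((√2 * (Real.cosh t ^ i * Real.sinh t ^ k) : ℝ) *
        ((hermitePoly (i + k + 1)).eval (B₁ (tangentVec t) x : ℂ) * deriv E (B₁ (coneVec t) x)))
      t := by
  have horth : B₁ (√2 • tangentVec t) (coneVec t) = 0 := by
    rw [B₁_smul_left, B₁_tangentVec_coneVec, mul_zero]
  refine (hasDerivAt_coneOp (hasDerivAt_coneVec t) horth 0 x _).congr_deriv ?_
  rw [createAlong_smul, LinearMap.smul_apply, map_smul, zero_add,
    coneOp_one_tangentVec_hermitePlane, smul_eq_mul, Complex.ofReal_mul √2, mul_assoc]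

end Plane

/-! ### Spherical polynomials as sums of products -/

section BlockProducts

open MvPolynomial

variable {ι τ R : Type*} [Fintype ι]

/-- The product of polynomials `h j` in disjoint blocks of variables, indexed by `j`. -/
def blockProd [CommSemiring R] (h : ι → MvPolynomial τ R) : MvPolynomial (ι × τ) R :=
  ∏ j, rename (Prod.mk j) (h j)

lemma eval_blockProd [CommSemiring R] (x : ι × τ → R) (h : ι → MvPolynomial τ R) :
    eval x (blockProd h) = ∏ j, eval (fun i => x (j, i)) (h j) := by
  rw [blockProd, map_prod]
  exact Finset.prod_congr rfl fun j _ => eval_rename _ _ _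

section Derivations

variable [DecidableEq ι]

lemma blockProd_update [CommSemiring R] (h : ι → MvPolynomial τ R) (j : ι) (g : MvPolynomial τ R) :
    blockProd (Function.update h j g) =
      rename (Prod.mk j) g * ∏ i ∈ Finset.univ.erase j, rename (Prod.mk i) (h i) := by
  rw [blockProd, ← Finset.mul_prod_erase _ _ (Finset.mem_univ j), Function.update_self]
  congr 1
  refine Finset.prod_congr rfl fun i hi => ?_
  rw [Function.update_of_ne (Finset.ne_of_mem_erase hi)]

lemma pderiv_prod_rename_erase [CommSemiring R] (h : ι → MvPolynomial τ R) (j : ι) (l : τ) :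
    pderiv (j, l) (∏ i ∈ Finset.univ.erase j, rename (Prod.mk i) (h i)) = 0 := by
  classical
  refine Finset.prod_induction _ (fun q => pderiv (j, l) q = 0) (fun p q hp hq => ?_) pderiv_one
    fun i hi => pderiv_eq_zero_of_notMem_vars fun hmem => ?_
  · rw [Derivation.leibniz, hp, hq, smul_zero, smul_zero, add_zero]
  · obtain ⟨_, _, heq⟩ := Finset.mem_image.mp (vars_rename (Prod.mk i) (h i) hmem)
    exact Finset.ne_of_mem_erase hi (Prod.mk.inj heq).1

lemma pderiv_blockProd [CommSemiring R] (h : ι → MvPolynomial τ R) (j : ι) (l : τ) :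
    pderiv (j, l) (blockProd h) = blockProd (Function.update h j (pderiv l (h j))) := by
  conv_lhs => rw [← Function.update_eq_self j h]
  rw [blockProd_update, blockProd_update, Derivation.leibniz, pderiv_prod_rename_erase, smul_zero,
    zero_add, smul_eq_mul, pderiv_rename (Prod.mk_right_injective j), mul_comm]

lemma create_blockProd [CommRing R] (w : τ → R) (h : ι → MvPolynomial τ R) (j : ι) (l : τ) :
    create (fun p : ι × τ => w p.2) (j, l) (blockProd h) =
      blockProd (Function.update h j (create w l (h j))) := by
  conv_lhs => rw [create_apply, pderiv_blockProd, ← Function.update_eq_self j h]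
  rw [create_apply, Function.update_idem, blockProd_update, blockProd_update, blockProd_update,
    Function.update_self, map_sub, map_mul, map_mul, rename_X, rename_C]
  ring

end Derivations

end BlockProducts

section Harmonic

open MvPolynomial

variable {m : ℕ}

/-- The operator `exp(-Δ/8π)` for the Laplace operator `Δ` of signature `(m, m)`, given on monomials
by products of the polynomials `hermitePlane`. -/
def hermiteMap (m : ℕ) : Poly m →ₗ[ℂ] Poly m :=
  (basisMonomials (Fin m × Fin 2) ℂ).constr ℂ fun α =>
    blockProd fun j => hermitePlane (α (j, 0)) (α (j, 1))

lemma hermiteMap_monomial (α : Fin m × Fin 2 →₀ ℕ) (a : ℂ) :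
    hermiteMap m (monomial α a) = a • blockProd fun j => hermitePlane (α (j, 0)) (α (j, 1)) := by
  have h : monomial α a = a • basisMonomials (Fin m × Fin 2) ℂ α := by
    rw [coe_basisMonomials, smul_monomial, smul_eq_mul, mul_one]
  rw [h, map_smul, hermiteMap, Module.Basis.constr_basis]

lemma hermiteMap_C (a : ℂ) : hermiteMap m (C a) = C a := by
  rw [← monomial_zero', hermiteMap_monomial, monomial_zero']
  simp [blockProd, hermitePlane, smul_eq_C_mul]

lemma hermiteMap_X_mul (p : Fin m × Fin 2) (g : Poly m) :
    hermiteMap m (X p * g) = create (fun q => planeWeight q.2) p (hermiteMap m g) := by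
  obtain ⟨j, l⟩ := p
  induction g using MvPolynomial.induction_on' with
  | add f g hf hg => rw [mul_add, map_add, map_add, hf, hg, map_add]
  | monomial α a =>
    rw [X, monomial_mul, one_mul, hermiteMap_monomial, hermiteMap_monomial, map_smul,
      create_blockProd]
    congr 2
    ext1 i
    rcases eq_or_ne i j with rfl | hij
    · rw [Function.update_self]
      fin_cases l
      · simp [← hermitePlane_succ_left, add_comm]
      · simp [← hermitePlane_succ_right, add_comm]
    · simp [Function.update_of_ne hij, hij.symm]

lemma sum_create_pderiv (f : Poly m) :
    ∑ p, create (fun q : Fin m × Fin 2 => planeWeight q.2) p (pderiv p f) =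
      ∑ p, X p * pderiv p f - C (1 / (4 * Real.pi : ℂ)) * laplace f := by
  rw [laplace, Finset.mul_sum]
  simp only [create_apply, Finset.sum_sub_distrib]
  congr 1
  rw [Fintype.sum_prod_type]
  refine Finset.sum_congr rfl fun j _ => ?_
  rw [Fin.sum_univ_two, planeWeight, Matrix.cons_val_zero, Matrix.cons_val_one,
    Matrix.cons_val_zero, neg_div, C_neg]
  ring

lemma laplace_pderiv (p : Fin m × Fin 2) (f : Poly m) :
    laplace (pderiv p f) = pderiv p (laplace f) := by
  rw [laplace, laplace, map_sum]
  refine Finset.sum_congr rfl fun j _ => ?_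
  rw [map_sub, pderiv_comm (j, 0) p f, pderiv_comm (j, 0) p, pderiv_comm (j, 1) p f,
    pderiv_comm (j, 1) p]

lemma IsSpherical.pderiv {d : ℕ} {f : Poly m} (hf : IsSpherical (d + 1) f) (p : Fin m × Fin 2) :
    IsSpherical d (pderiv p f) :=
  ⟨hf.1.pderiv, by rw [laplace_pderiv, hf.2, map_zero]⟩

-- Induction on the degree through Euler's identity `∑ X_p ∂_p f = d f`.
lemma IsSpherical.hermiteMap_eq_self {d : ℕ} {f : Poly m} (hf : IsSpherical d f) :
    hermiteMap m f = f := by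
  induction d generalizing f with
  | zero =>
    rw [totalDegree_eq_zero_iff_eq_C.mp (Nat.le_zero.mp hf.1.totalDegree_le), hermiteMap_C]
  | succ d ih =>
    have hEuler : ((d + 1 : ℕ) : ℂ) • hermiteMap m f = ((d + 1 : ℕ) : ℂ) • f := by
      calc ((d + 1 : ℕ) : ℂ) • hermiteMap m f
        _ = hermiteMap m (∑ p, X p * MvPolynomial.pderiv p f) := by
          rw [hf.1.sum_X_mul_pderiv, map_nsmul, Nat.cast_smul_eq_nsmul]
        _ = ∑ p, create (fun q => planeWeight q.2) p (MvPolynomial.pderiv p f) := by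
          rw [map_sum]
          exact Finset.sum_congr rfl fun p _ => by rw [hermiteMap_X_mul, ih (hf.pderiv p)]
        _ = ((d + 1 : ℕ) : ℂ) • f := by
          rw [sum_create_pderiv, hf.2, mul_zero, sub_zero, hf.1.sum_X_mul_pderiv,
            Nat.cast_smul_eq_nsmul]
    exact smul_right_injective _ (Nat.cast_ne_zero.mpr d.succ_ne_zero) hEuler

lemma IsSpherical.eq_sum_blockProd {d : ℕ} {f : Poly m} (hf : IsSpherical d f) :
    f = ∑ α ∈ f.support, coeff α f • blockProd fun j => hermitePlane (α (j, 0)) (α (j, 1)) := by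
  conv_lhs => rw [← hf.hermiteMap_eq_self, f.as_sum, map_sum]
  exact Finset.sum_congr rfl fun α _ => hermiteMap_monomial _ _

lemma IsSpherical.sum_eq_of_mem_support {d : ℕ} {f : Poly m} (hf : IsSpherical d f)
    {α : Fin m × Fin 2 →₀ ℕ} (hα : α ∈ f.support) : ∑ j, (α (j, 0) + α (j, 1)) = d := by
  have h : α.degree = d := of_not_not fun hne => mem_support_iff.mp hα (hf.1.coeff_eq_zero hne)
  rw [← h, Finsupp.degree_eq_sum, Fintype.sum_prod_type]
  exact Finset.sum_congr rfl fun j _ => (Fin.sum_univ_two fun l => α (j, l)).symm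

end Harmonic

section Kernel

open MvPolynomial

lemma sum_range_sum_piAntidiag_prod {ι R : Type*} [Fintype ι] [DecidableEq ι] [CommSemiring R]
    {a : ι → ℕ → R} {e : ι → ℕ} {d : ℕ} (ha : ∀ j k, e j < k → a j k = 0) (hd : ∑ j, e j ≤ d) :
    ∑ k ∈ Finset.range (d + 1), ∑ κ ∈ Finset.piAntidiag Finset.univ k, ∏ j, a j (κ j) =
      ∏ j, ∑ k ∈ Finset.range (e j + 1), a j k := by
  have hmaps : ∀ κ ∈ Fintype.piFinset fun j => Finset.range (e j + 1),
      ∑ j, κ j ∈ Finset.range (d + 1) := fun κ hκ =>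
    Finset.mem_range_succ_iff.mpr <| le_trans (Finset.sum_le_sum fun j _ =>
      Finset.mem_range_succ_iff.mp (Fintype.mem_piFinset.mp hκ j)) hd
  rw [Finset.prod_univ_sum, ← Finset.sum_fiberwise_of_maps_to hmaps]
  refine Finset.sum_congr rfl fun k _ =>
    (Finset.sum_subset (fun κ hκ => ?_) fun κ hκ hκ' => ?_).symm
  · exact Finset.mem_piAntidiag.mpr ⟨(Finset.mem_filter.mp hκ).2, fun j _ => Finset.mem_univ j⟩
  · have hbig : ¬ ∀ j, κ j ∈ Finset.range (e j + 1) := fun hall => hκ' <|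
      Finset.mem_filter.mpr ⟨Fintype.mem_piFinset.mpr hall, (Finset.mem_piAntidiag.mp hκ).1⟩
    obtain ⟨j, hj⟩ := not_forall.mp hbig
    exact Finset.prod_eq_zero (Finset.mem_univ j) (ha j _ (by simpa using hj))

lemma sum_neg_one_pow_sum_mul_prod {ι R : Type*} [Fintype ι] [DecidableEq ι] [CommRing R]
    (a : ι → Fin 2 → R) :
    ∑ σ : ι → Fin 2, (-1) ^ (∑ j, (σ j : ℕ)) * ∏ j, a j (σ j) = ∏ j, (a j 0 - a j 1) := by
  have h (j : ι) : a j 0 - a j 1 = ∑ s : Fin 2, (-1) ^ (s : ℕ) * a j s := by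
    simp [Fin.sum_univ_two, sub_eq_add_neg]
  simp only [h, Finset.prod_univ_sum, Fintype.piFinset_univ, Finset.prod_mul_distrib,
    Finset.prod_pow_eq_pow_sum]

variable {m : ℕ}

/-- The vector `c / √(-Q₁(c))`. -/
def unitVec (c : Fin 2 → ℝ) : Fin 2 → ℝ := (√(-Q₁ c))⁻¹ • c

lemma B₁_unitVec (c x : Fin 2 → ℝ) : B₁ (unitVec c) x = B₁ c x / √(-Q₁ c) := by
  rw [unitVec, B₁_smul_left, inv_mul_eq_div]

lemma dirDeriv_blockProd (c : Fin 2 → ℝ) (j : Fin m) (h : Fin m → MvPolynomial (Fin 2) ℂ) :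
    dirDeriv c j (blockProd h) =
      blockProd (Function.update h j (planeDeriv (unitVec c) (h j))) := by
  have e : dirDeriv c j (blockProd h) = C (unitVec c 0 : ℂ) * pderiv (j, 0) (blockProd h)
      + C (unitVec c 1 : ℂ) * pderiv (j, 1) (blockProd h) := by
    simp only [dirDeriv, unitVec, LinearMap.smul_apply, LinearMap.add_apply, smul_add, smul_smul,
      smul_eq_C_mul, Derivation.coeFn_coe, Pi.smul_apply, smul_eq_mul, one_div, Complex.ofReal_mul]
  rw [e, pderiv_blockProd, pderiv_blockProd, blockProd_update, blockProd_update, blockProd_update,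
    planeDeriv_apply, map_add, map_mul, map_mul, rename_C, rename_C]
  ring

lemma dirDeriv_pow_blockProd (c : Fin 2 → ℝ) (j : Fin m) (k : ℕ)
    (h : Fin m → MvPolynomial (Fin 2) ℂ) : (dirDeriv c j ^ k) (blockProd h) =
      blockProd (Function.update h j (((planeDeriv (unitVec c)).toLinearMap ^ k) (h j))) := by
  induction k with
  | zero => simp
  | succ k ih =>
    rw [pow_succ', Module.End.mul_apply, ih, dirDeriv_blockProd, Function.update_self,
      Function.update_idem, pow_succ', Module.End.mul_apply, Derivation.coeFn_coe]

lemma list_prod_dirDeriv_blockProd (c : Fin m → Fin 2 → ℝ) (κ : Fin m → ℕ)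
    (h : Fin m → MvPolynomial (Fin 2) ℂ) {l : List (Fin m)} (hl : l.Nodup) :
    (l.map fun j => dirDeriv (c j) j ^ κ j).prod (blockProd h) = blockProd fun j =>
      if j ∈ l then ((planeDeriv (unitVec (c j))).toLinearMap ^ κ j) (h j) else h j := by
  induction l with
  | nil => simp
  | cons i l ih =>
    rw [List.map_cons, List.prod_cons, Module.End.mul_apply, ih hl.of_cons,
      dirDeriv_pow_blockProd]
    congr 1
    ext1 j
    rcases eq_or_ne j i with rfl | hj
    · simp [(List.nodup_cons.mp hl).1]
    · simp [hj]

lemma G_blockProd (h : Fin m → MvPolynomial (Fin 2) ℂ) (c : Fin m → Fin 2 → ℝ) (κ : Fin m → ℕ)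
    (x : Vec m) : G (blockProd h) c κ x =
      ∏ j, (κ j).factorial * (planeRestrict (x.comp j) (unitVec (c j)) (h j)).coeff (κ j) := by
  rw [G, List.ofFn_eq_map, list_prod_dirDeriv_blockProd _ _ _ (List.nodup_finRange m),
    eval_blockProd]
  refine Finset.prod_congr rfl fun j _ => ?_
  rw [if_pos (List.mem_finRange j)]
  exact eval_lineDerivation_pow _ _ _ _

lemma F_mul_G_blockProd (c : Fin m → Fin 2 → ℝ) (h : Fin m → MvPolynomial (Fin 2) ℂ)
    (κ : Fin m → ℕ) (x : Vec m) :
    (-1) ^ (∑ j, κ j) / (4 * (Real.pi : ℂ)) ^ (∑ j, κ j) * (F c κ x * G (blockProd h) c κ x) =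
      ∏ j, (planeRestrict (x.comp j) (unitVec (c j)) (h j)).coeff (κ j)
        * coneWeight 0 (B₁ (unitVec (c j)) (x.comp j)) (κ j) := by
  rw [← div_pow, ← Finset.prod_pow_eq_pow_sum, F, G_blockProd, Complex.ofReal_prod,
    ← Finset.prod_mul_distrib, ← Finset.prod_mul_distrib]
  refine Finset.prod_congr rfl fun j _ => ?_
  have hfac : ((κ j).factorial : ℂ) ≠ 0 := Nat.cast_ne_zero.mpr (κ j).factorial_ne_zero
  rw [coneWeight, B₁_unitVec, add_zero]
  push_cast
  field_simp

lemma sum_F_mul_G_blockProd (c : Fin m → Fin 2 → ℝ) {d : ℕ} {h : Fin m → MvPolynomial (Fin 2) ℂ}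
    (hd : ∑ j, (h j).totalDegree ≤ d) (x : Vec m) :
    ∑ k ∈ Finset.range (d + 1), ((-1 : ℂ) ^ k / (4 * (Real.pi : ℂ)) ^ k) *
      ∑ κ ∈ Finset.piAntidiag (Finset.univ : Finset (Fin m)) k,
        (F c κ x : ℂ) * G (blockProd h) c κ x =
    ∏ j, coneOp 0 (unitVec (c j)) (x.comp j) (h j) := by
  have hle (j : Fin m) := natDegree_lineRestrict_le (fun i => (x.comp j i : ℂ))
    (fun i => (unitVec (c j) i : ℂ)) (h j)
  have hcone (j : Fin m) := coeffFunctional_eq_sum_range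
    (coneWeight 0 (B₁ (unitVec (c j)) (x.comp j))) (Nat.lt_succ_of_le (hle j))
  refine Eq.trans (Finset.sum_congr rfl fun k _ => ?_)
    ((sum_range_sum_piAntidiag_prod (fun j k hk => ?_) hd).trans
      (Finset.prod_congr rfl fun j _ => (hcone j).symm))
  · rw [Finset.mul_sum]
    refine Finset.sum_congr rfl fun κ hκ => ?_
    rw [← (Finset.mem_piAntidiag.mp hκ).1]
    exact F_mul_G_blockProd c h κ x
  · rw [Polynomial.coeff_eq_zero_of_natDegree_lt ((hle j).trans_lt hk), zero_mul]

lemma kernel_blockProd (c₀ c₁ : Fin m → Fin 2 → ℝ) {d : ℕ} {h : Fin m → MvPolynomial (Fin 2) ℂ}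
    (hd : ∑ j, (h j).totalDegree ≤ d) (x : Vec m) :
    kernel c₀ c₁ d (blockProd h) x = ∏ j, (coneOp 0 (unitVec (c₀ j)) (x.comp j) (h j)
      - coneOp 0 (unitVec (c₁ j)) (x.comp j) (h j)) := by
  simp only [kernel, sum_F_mul_G_blockProd _ hd]
  exact sum_neg_one_pow_sum_mul_prod fun j s =>
    coneOp 0 (unitVec (if s = 0 then c₀ j else c₁ j)) (x.comp j) (h j)

/-- The kernel as a linear functional of the polynomial. -/
def kernelFunctional (c₀ c₁ : Fin m → Fin 2 → ℝ) (d : ℕ) (x : Vec m) : Poly m →ₗ[ℂ] ℂ where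
  toFun f := kernel c₀ c₁ d f x
  map_add' f g := by
    simp only [kernel, G, map_add, mul_add, Finset.sum_add_distrib]
  map_smul' a f := by
    simp only [kernel, G, map_smul, smul_eval, RingHom.id_apply, smul_eq_mul, Finset.mul_sum,
      mul_left_comm a]

lemma kernel_sum_smul (c₀ c₁ : Fin m → Fin 2 → ℝ) (d : ℕ) {ι : Type*} (s : Finset ι) (a : ι → ℂ)
    (g : ι → Poly m) (x : Vec m) :
    kernel c₀ c₁ d (∑ i ∈ s, a i • g i) x = ∑ i ∈ s, a i * kernel c₀ c₁ d (g i) x := by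
  change kernelFunctional c₀ c₁ d x _ = ∑ i ∈ s, a i * kernelFunctional c₀ c₁ d x (g i)
  simp only [map_sum, map_smul, smul_eq_mul]

/-- The hyperbolic angle of a vector in the negative cone. -/
def coneAngle (c : Fin 2 → ℝ) : ℝ := Real.arsinh (c 0 / (√2 * √(-Q₁ c)))

lemma coneVec_coneAngle {c : Fin 2 → ℝ} (hc : c ∈ negCone) : coneVec (coneAngle c) = unitVec c := by
  obtain ⟨hQ, hpos⟩ := hc
  have hr : 0 < √(-Q₁ c) := Real.sqrt_pos.mpr (neg_pos.mpr hQ)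
  have h2 : √2 ^ 2 = (2 : ℝ) := Real.sq_sqrt zero_le_two
  have hcosh : Real.cosh (coneAngle c) = c 1 / (√2 * √(-Q₁ c)) := by
    rw [coneAngle, Real.cosh_arsinh, Real.sqrt_eq_iff_mul_self_eq_of_pos (by positivity)]
    have hr2 : √(-Q₁ c) ^ 2 = (c 1 ^ 2 - c 0 ^ 2) / 2 := by
      rw [Real.sq_sqrt (neg_pos.mpr hQ).le, Q₁]
      ring
    field_simp
    rw [h2, hr2]
    ring
  rw [coneVec, hcosh, coneAngle, Real.sinh_arsinh]
  ext i
  fin_cases i <;> simp [unitVec] <;> field_simp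

/-- The kernel of one plane for the monomial `x^i y^k` and the cone vectors with the angles `t₀`
and `t₁`. -/
def planeKernel (t₀ t₁ : ℝ) (i k : ℕ) (x : Fin 2 → ℝ) : ℂ :=
  coneOp 0 (coneVec t₀) x (hermitePlane i k) - coneOp 0 (coneVec t₁) x (hermitePlane i k)

lemma IsSpherical.kernel_eq_sum_prod {c₀ c₁ : Fin m → Fin 2 → ℝ} (hc₀ : ∀ j, c₀ j ∈ negCone)
    (hc₁ : ∀ j, c₁ j ∈ negCone) {d : ℕ} {f : Poly m} (hf : IsSpherical d f) (x : Vec m) :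
    kernel c₀ c₁ d f x = ∑ α ∈ f.support, coeff α f * ∏ j, planeKernel (coneAngle (c₀ j))
      (coneAngle (c₁ j)) (α (j, 0)) (α (j, 1)) (x.comp j) := by
  conv_lhs => rw [hf.eq_sum_blockProd, kernel_sum_smul]
  refine Finset.sum_congr rfl fun α hα => ?_
  have hdeg : ∑ j, (hermitePlane (α (j, 0)) (α (j, 1))).totalDegree ≤ d :=
    hf.sum_eq_of_mem_support hα ▸ Finset.sum_le_sum fun j _ => totalDegree_hermitePlane_le _ _
  rw [kernel_blockProd c₀ c₁ hdeg]
  simp only [planeKernel, coneVec_coneAngle (hc₀ _), coneVec_coneAngle (hc₁ _)]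

end Kernel

section ProductSums

lemma summable_norm_prod {R κ : Type*} [NormedField R] {m : ℕ} {f : Fin m → κ → R}
    (hf : ∀ j, Summable fun n => ‖f j n‖) : Summable fun n : Fin m → κ => ‖∏ j, f j (n j)‖ := by
  induction m with
  | zero => exact Summable.of_finite
  | succ m ih =>
    rw [← (Fin.consEquiv fun _ => κ).summable_iff]
    refine ((hf 0).mul_norm (ih fun j => hf j.succ)).congr fun p => ?_
    simp only [Function.comp_apply, Fin.consEquiv_apply, Fin.prod_univ_succ, Fin.cons_zero,
      Fin.cons_succ]

lemma tsum_prod {R κ : Type*} [NormedField R] [CompleteSpace R] {m : ℕ} {f : Fin m → κ → R}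
    (hf : ∀ j, Summable fun n => ‖f j n‖) :
    ∑' n : Fin m → κ, ∏ j, f j (n j) = ∏ j, ∑' n, f j n := by
  induction m with
  | zero => simp
  | succ m ih =>
    rw [← (Fin.consEquiv fun _ => κ).tsum_eq, Fin.prod_univ_succ, ← ih fun j => hf j.succ,
      tsum_mul_tsum_of_summable_norm (hf 0) (summable_norm_prod fun j => hf j.succ)]
    simp only [Fin.consEquiv_apply, Fin.prod_univ_succ, Fin.cons_zero, Fin.cons_succ]

end ProductSums

section Poisson

open MeasureTheory
open scoped FourierTransform

/-! ### Poisson summation on `ℤ ^ ι` -/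

variable {ι : Type*}

/-- The point of `ℝ ^ ι` with integer coordinates `n`. -/
def latticePoint (n : ι → ℤ) : ι → ℝ := fun i => n i

lemma latticePoint_add (n l : ι → ℤ) : latticePoint (n + l) = latticePoint n + latticePoint l :=
  funext fun _ => Int.cast_add _ _

lemma latticePoint_neg (n : ι → ℤ) : latticePoint (-n) = -latticePoint n :=
  funext fun _ => Int.cast_neg _

/-- The half-open cube of side `1` with lower corner `a`. -/
def unitCube (a : ι → ℝ) : Set (ι → ℝ) := Set.univ.pi fun i => Set.Ioc (a i) (a i + 1)

lemma iUnion_unitCube : ⋃ n : ι → ℤ, unitCube (latticePoint n) = Set.univ := by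
  simp only [unitCube, latticePoint]
  rw [Set.iUnion_univ_pi fun (_ : ι) (n : ℤ) => Set.Ioc (n : ℝ) (n + 1)]
  simp only [iUnion_Ioc_intCast, Set.pi_univ]

lemma pairwise_disjoint_unitCube :
    Pairwise (Function.onFun Disjoint fun n : ι → ℤ => unitCube (latticePoint n)) := by
  intro n l hne
  obtain ⟨i, hi⟩ := Function.ne_iff.mp hne
  exact Set.disjoint_univ_pi.mpr ⟨i, Set.pairwise_disjoint_Ioc_intCast ℝ hi⟩

lemma measurableSet_unitCube [Countable ι] (a : ι → ℝ) : MeasurableSet (unitCube a) :=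
  MeasurableSet.univ_pi fun _ => measurableSet_Ioc

/-- The sum of the translates of `F` by lattice points. -/
def periodization (F : (ι → ℝ) → ℂ) (x : ι → ℝ) : ℂ := ∑' n : ι → ℤ, F (x + latticePoint n)

lemma periodization_add_latticePoint (F : (ι → ℝ) → ℂ) (x : ι → ℝ) (l : ι → ℤ) :
    periodization F (x + latticePoint l) = periodization F x := by
  rw [periodization, periodization, ← (Equiv.addLeft l).tsum_eq fun n => F (x + latticePoint n)]
  simp only [Equiv.coe_addLeft, latticePoint_add, add_assoc]

lemma exists_continuousMap_unitAddTorus {P : (ι → ℝ) → ℂ} (hP : Continuous P)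
    (hper : ∀ x (l : ι → ℤ), P (x + latticePoint l) = P x) :
    ∃ G : C(UnitAddTorus ι, ℂ), ∀ x : ι → ℝ, G (fun i => (x i : UnitAddCircle)) = P x := by
  have hq : IsOpenQuotientMap (Pi.map fun (_ : ι) (y : ℝ) => (y : UnitAddCircle)) :=
    IsOpenQuotientMap.piMap fun _ => QuotientAddGroup.isOpenQuotientMap_mk
  let π : C(ι → ℝ, UnitAddTorus ι) := ⟨_, hq.continuous⟩
  have hfac : Function.FactorsThrough (⟨P, hP⟩ : C(ι → ℝ, ℂ)) π := by
    intro x y hxy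
    have hint : ∀ i, ∃ l : ℤ, (l : ℝ) = y i - x i := fun i => by
      have hi : (y i : UnitAddCircle) = x i := (congrFun hxy i).symm
      obtain ⟨l, hl⟩ := AddSubgroup.mem_zmultiples_iff.mp (QuotientAddGroup.eq_iff_sub_mem.mp hi)
      exact ⟨l, by rw [← hl, zsmul_one]⟩
    choose l hl using hint
    have hy : y = x + latticePoint l := funext fun i => by simp [latticePoint, hl]
    exact (hper x l).symm.trans (congrArg P hy.symm)
  have hπ : Topology.IsQuotientMap π := hq.isQuotientMap
  exact ⟨hπ.lift _ hfac, fun x => congrArg (fun g : C(ι → ℝ, ℂ) => g x) (hπ.lift_comp _ hfac)⟩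

variable [Fintype ι]

/-- The Gaussian `exp (-ε |x|²)` for the Euclidean norm, which is not the norm of `ι → ℝ`. -/
def gaussianWeight (ε : ℝ) (x : ι → ℝ) : ℝ := Real.exp (-ε * ∑ i, x i ^ 2)

lemma gaussianWeight_pos (ε : ℝ) (x : ι → ℝ) : 0 < gaussianWeight ε x := Real.exp_pos _

lemma gaussianWeight_eq_prod (ε : ℝ) (x : ι → ℝ) :
    gaussianWeight ε x = ∏ i, Real.exp (-ε * x i ^ 2) := by
  rw [gaussianWeight, Finset.mul_sum, Real.exp_sum]

lemma integrable_gaussianWeight {ε : ℝ} (hε : 0 < ε) :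
    Integrable (gaussianWeight ε : (ι → ℝ) → ℝ) := by
  simp only [funext (gaussianWeight_eq_prod ε)]
  exact Integrable.fintype_prod (f := fun _ y => Real.exp (-ε * y ^ 2))
    fun _ => integrable_exp_neg_mul_sq hε

lemma summable_exp_neg_mul_int_sq {ε : ℝ} (hε : 0 < ε) :
    Summable fun n : ℤ => Real.exp (-ε * (n : ℝ) ^ 2) := by
  have him : 0 < (Complex.I * (ε / Real.pi : ℝ)).im := by
    rw [Complex.I_mul_im, Complex.ofReal_re]
    positivity
  refine ((summable_jacobiTheta₂_term_iff 0 _).mpr him).norm.congr fun n => ?_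
  rw [norm_jacobiTheta₂_term, Complex.I_mul_im, Complex.ofReal_re, Complex.zero_im]
  congr 1
  field_simp
  ring

lemma summable_gaussianWeight_latticePoint {ε : ℝ} (hε : 0 < ε) :
    Summable fun n : ι → ℤ => gaussianWeight ε (latticePoint n) := by
  rw [← (Equiv.arrowCongr (Fintype.equivFin ι).symm (Equiv.refl ℤ)).summable_iff]
  refine (summable_norm_prod (m := Fintype.card ι) (f := fun _ (n : ℤ) => Real.exp (-ε * n ^ 2))
    fun _ => (summable_exp_neg_mul_int_sq hε).norm).congr fun n => ?_
  rw [norm_prod, Function.comp_apply, gaussianWeight_eq_prod,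
    ← (Fintype.equivFin ι).prod_comp fun j => ‖Real.exp (-ε * n j ^ 2)‖]
  exact Finset.prod_congr rfl fun i _ => Real.norm_of_nonneg (Real.exp_nonneg _)

lemma gaussianWeight_add_le {ε : ℝ} (hε : 0 ≤ ε) {R : ℝ} {x : ι → ℝ} (hx : ∀ i, |x i| ≤ R)
    (y : ι → ℝ) :
    gaussianWeight ε (x + y) ≤
      Real.exp (ε * (Fintype.card ι * R ^ 2)) * gaussianWeight (ε / 2) y := by
  have hle : ∑ i, (y i ^ 2 / 2 - R ^ 2) ≤ ∑ i, (x + y) i ^ 2 := by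
    refine Finset.sum_le_sum fun i _ => ?_
    rw [Pi.add_apply]
    nlinarith [sq_nonneg (2 * x i + y i), sq_le_sq' (abs_le.mp (hx i)).1 (abs_le.mp (hx i)).2]
  rw [Finset.sum_sub_distrib, ← Finset.sum_div, Finset.sum_const, Finset.card_univ,
    nsmul_eq_mul] at hle
  rw [gaussianWeight, gaussianWeight, ← Real.exp_add]
  exact Real.exp_le_exp.mpr (by nlinarith)

lemma norm_add_latticePoint_le {F : (ι → ℝ) → ℂ} {A ε : ℝ} (hε : 0 ≤ ε)
    (hF : ∀ x, ‖F x‖ ≤ A * gaussianWeight ε x) {R : ℝ} {x : ι → ℝ} (hx : ∀ i, |x i| ≤ R)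
    (n : ι → ℤ) :
    ‖F (x + latticePoint n)‖ ≤ A * Real.exp (ε * (Fintype.card ι * R ^ 2)) *
      gaussianWeight (ε / 2) (latticePoint n) := by
  have hA : 0 ≤ A := nonneg_of_mul_nonneg_left ((norm_nonneg _).trans (hF 0))
    (gaussianWeight_pos ε 0)
  rw [mul_assoc]
  exact (hF _).trans (mul_le_mul_of_nonneg_left (gaussianWeight_add_le hε hx _) hA)

lemma volume_unitCube_ne_top (a : ι → ℝ) : volume (unitCube a) ≠ ⊤ := by
  simp [unitCube, volume_pi_pi]

lemma hasSum_integral_unitCube {F : (ι → ℝ) → ℂ} (hF : Integrable F) :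
    HasSum (fun n : ι → ℤ => ∫ x in unitCube 0, F (x + latticePoint n)) (∫ x, F x) := by
  have h := hasSum_integral_iUnion (μ := volume) (f := F)
    (fun n : ι → ℤ => measurableSet_unitCube (latticePoint n)) pairwise_disjoint_unitCube
    hF.integrableOn
  rw [iUnion_unitCube, setIntegral_univ] at h
  convert! h using 2 with n
  have hpre : (fun x => x + latticePoint n) ⁻¹' unitCube (latticePoint n) = unitCube 0 := by
    ext x
    simp only [unitCube, latticePoint, Set.mem_preimage, Set.mem_univ_pi, Set.mem_Ioc,
      Pi.add_apply, Pi.zero_apply, zero_add, add_comm (x _), add_le_add_iff_left,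
      lt_add_iff_pos_right]
  rw [← (measurePreserving_add_right volume (latticePoint n)).setIntegral_preimage_emb
    (measurableEmbedding_addRight _) F, hpre]

/-- The Fourier transform on `ℝ ^ ι` for the dot product. Mathlib's `𝓕` does not apply, since
`ι → ℝ` is not an inner product space. -/
def piFourier (F : (ι → ℝ) → ℂ) (ξ : ι → ℝ) : ℂ := ∫ x, 𝐞 (-(x ⬝ᵥ ξ)) • F x

lemma fourierChar_dotProduct_latticePoint (n k : ι → ℤ) :
    𝐞 (latticePoint n ⬝ᵥ latticePoint k) = 1 := by
  have h : latticePoint n ⬝ᵥ latticePoint k = (n ⬝ᵥ k : ℤ) := by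
    simp [latticePoint, dotProduct]
  rw [h, Real.fourierChar_apply', Circle.exp_two_pi_mul_int]

lemma mFourier_coe (k : ι → ℤ) (x : ι → ℝ) :
    UnitAddTorus.mFourier k (fun i => (x i : UnitAddCircle)) = 𝐞 (x ⬝ᵥ latticePoint k) := by
  rw [UnitAddTorus.mFourier, ContinuousMap.coe_mk, Real.fourierChar_apply, dotProduct,
    Finset.mul_sum, Complex.ofReal_sum, Finset.sum_mul, Complex.exp_sum]
  refine Finset.prod_congr rfl fun i _ => ?_
  rw [fourier_coe_apply, latticePoint]
  congr 1
  push_cast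
  ring

section GaussianDecay

variable {F : (ι → ℝ) → ℂ} {A ε : ℝ}

lemma integrable_of_norm_le_gaussianWeight (hF : Continuous F) (hε : 0 < ε)
    (hb : ∀ x, ‖F x‖ ≤ A * gaussianWeight ε x) : Integrable F :=
  ((integrable_gaussianWeight hε).const_mul A).mono' hF.aestronglyMeasurable
    (Filter.Eventually.of_forall hb)

lemma continuous_periodization (hF : Continuous F) (hε : 0 < ε)
    (hb : ∀ x, ‖F x‖ ≤ A * gaussianWeight ε x) : Continuous (periodization F) := by
  refine continuous_iff_continuousAt.mpr fun x₀ => ContinuousOn.continuousAt ?_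
    (Metric.isOpen_ball.mem_nhds (mem_ball_zero_iff.mpr (lt_add_one ‖x₀‖)))
  exact continuousOn_tsum (fun n => (hF.comp (continuous_add_const _)).continuousOn)
    ((summable_gaussianWeight_latticePoint (half_pos hε)).mul_left _) fun n x hx =>
      norm_add_latticePoint_le hε.le hb
        (fun i => (norm_le_pi_norm x i).trans (mem_ball_zero_iff.mp hx).le) n

lemma integral_unitCube_periodization (hF : Continuous F) (hε : 0 < ε)
    (hb : ∀ x, ‖F x‖ ≤ A * gaussianWeight ε x) :
    ∫ x in unitCube 0, periodization F x = ∫ x, F x := by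
  have hbound : ∀ x ∈ unitCube (0 : ι → ℝ), ∀ n : ι → ℤ, ‖F (x + latticePoint n)‖ ≤ _ :=
    fun x hx => norm_add_latticePoint_le hε.le hb (R := 1) fun i => by
      have hi : x i ∈ Set.Ioc (0 : ℝ) (0 + 1) := hx i (Set.mem_univ i)
      exact abs_le.mpr ⟨by linarith [hi.1], by linarith [hi.2]⟩
  have hsum := (summable_gaussianWeight_latticePoint (ι := ι) (half_pos hε)).mul_left
    (A * Real.exp (ε * (Fintype.card ι * 1 ^ 2)))
  have hcube : ∀ᵐ x ∂volume.restrict (unitCube (0 : ι → ℝ)), x ∈ unitCube (0 : ι → ℝ) :=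
    ae_restrict_mem (measurableSet_unitCube 0)
  rw [← (hasSum_integral_unitCube (integrable_of_norm_le_gaussianWeight hF hε hb)).tsum_eq]
  refine (hasSum_integral_of_dominated_convergence (fun n _ => _)
    (fun n => (hF.comp (continuous_add_const _)).aestronglyMeasurable)
    (fun n => hcube.mono fun x hx => hbound x hx n)
    (Filter.Eventually.of_forall fun _ => hsum) (integrableOn_const (volume_unitCube_ne_top 0))
    (hcube.mono fun x hx => ?_)).tsum_eq.symm
  exact (Summable.of_norm_bounded hsum (hbound x hx)).hasSum

lemma mFourierCoeff_eq_piFourier (hF : Continuous F) (hε : 0 < ε)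
    (hb : ∀ x, ‖F x‖ ≤ A * gaussianWeight ε x) {G : UnitAddTorus ι → ℂ}
    (hG : ∀ x : ι → ℝ, G (fun i => x i) = periodization F x) (k : ι → ℤ) :
    UnitAddTorus.mFourierCoeff G k = piFourier F (latticePoint k) := by
  let H : (ι → ℝ) → ℂ := fun x => 𝐞 (-(x ⬝ᵥ latticePoint k)) • F x
  have hH : Continuous H := (Real.continuous_fourierChar.comp
    (Continuous.dotProduct continuous_id continuous_const).neg).smul hF
  have hbH : ∀ x, ‖H x‖ ≤ A * gaussianWeight ε x := fun x =>
    (Circle.norm_smul _ _).trans_le (hb x)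
  have hper : ∀ x, UnitAddTorus.mFourier (-k) (fun i => (x i : UnitAddCircle)) •
      G (fun i => x i) = periodization H x := by
    intro x
    rw [hG, mFourier_coe, periodization, ← tsum_const_smul'', periodization]
    refine tsum_congr fun n => ?_
    rw [← Circle.smul_def]
    simp only [H]
    rw [add_dotProduct, neg_add, AddChar.map_add_eq_mul, ← dotProduct_neg,
      ← dotProduct_neg (latticePoint n), ← latticePoint_neg, fourierChar_dotProduct_latticePoint,
      mul_one]
  rw [UnitAddTorus.mFourierCoeff_eq_integral _ _ 0, piFourier,
    ← integral_unitCube_periodization hH hε hbH]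
  simp only [hper, unitCube, Set.pi, Set.mem_univ, forall_const]

theorem tsum_latticePoint_eq_tsum_piFourier (hF : Continuous F) (hε : 0 < ε)
    (hb : ∀ x, ‖F x‖ ≤ A * gaussianWeight ε x)
    (hs : Summable fun k : ι → ℤ => piFourier F (latticePoint k)) :
    ∑' n : ι → ℤ, F (latticePoint n) = ∑' k : ι → ℤ, piFourier F (latticePoint k) := by
  obtain ⟨G, hG⟩ := exists_continuousMap_unitAddTorus (continuous_periodization hF hε hb)
    (periodization_add_latticePoint F)
  have hcoeff := mFourierCoeff_eq_piFourier hF hε hb hG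
  have hsum := UnitAddTorus.hasSum_mFourier_series_apply_of_summable
    (by rwa [funext hcoeff]) fun i => ((0 : ι → ℝ) i : UnitAddCircle)
  rw [hG, periodization] at hsum
  simp only [zero_add, hcoeff, mFourier_coe, zero_dotProduct, AddChar.map_zero_eq_one,
    Circle.coe_one, smul_eq_mul, mul_one] at hsum
  exact hsum.tsum_eq.symm

lemma piFourier_fourierChar_smul_comp_add (F : (ι → ℝ) → ℂ) (a b ξ : ι → ℝ) :
    piFourier (fun x => 𝐞 ((a + x) ⬝ᵥ b) • F (a + x)) ξ = 𝐞 (a ⬝ᵥ ξ) • piFourier F (ξ - b) := by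
  rw [piFourier, ← integral_add_left_eq_self _ (-a), piFourier, Circle.smul_def, ← integral_smul]
  refine integral_congr_ae (Filter.Eventually.of_forall fun x => ?_)
  simp only [add_neg_cancel_left, ← Circle.smul_def, smul_smul, ← AddChar.map_add_eq_mul]
  congr 2
  rw [add_dotProduct, neg_dotProduct, dotProduct_sub]
  ring

theorem tsum_fourierChar_smul_add_latticePoint (hF : Continuous F) (hε : 0 < ε)
    (hb : ∀ x, ‖F x‖ ≤ A * gaussianWeight ε x) (a b : ι → ℝ)
    (hs : Summable fun k : ι → ℤ =>
      𝐞 (a ⬝ᵥ latticePoint k) • piFourier F (latticePoint k - b)) :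
    ∑' n : ι → ℤ, 𝐞 ((a + latticePoint n) ⬝ᵥ b) • F (a + latticePoint n) =
      ∑' k : ι → ℤ, 𝐞 (a ⬝ᵥ latticePoint k) • piFourier F (latticePoint k - b) := by
  have hA : 0 ≤ A := nonneg_of_mul_nonneg_left ((norm_nonneg _).trans (hb 0))
    (gaussianWeight_pos ε 0)
  have hcont : Continuous fun x => 𝐞 ((a + x) ⬝ᵥ b) • F (a + x) :=
    (Real.continuous_fourierChar.comp (Continuous.dotProduct (continuous_const_add a)
      continuous_const)).smul (hF.comp (continuous_const_add a))
  simp only [← piFourier_fourierChar_smul_comp_add] at hs ⊢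
  refine tsum_latticePoint_eq_tsum_piFourier
    (A := A * Real.exp (ε * (Fintype.card ι * ‖a‖ ^ 2))) hcont (half_pos hε) (fun x => ?_) hs
  rw [Circle.norm_smul]
  refine ((hb _).trans (mul_le_mul_of_nonneg_left (gaussianWeight_add_le hε.le
    (fun i => norm_le_pi_norm a i) x) hA)).trans_eq (mul_assoc _ _ _).symm

end GaussianDecay

end Poisson

section Boost

open MeasureTheory

/-! ### Lorentz boosts of the plane -/

/-- The Lorentz boost of rapidity `t`, an isometry of the form `B₁`. -/
def boost (t : ℝ) (x : Fin 2 → ℝ) : Fin 2 → ℝ :=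
  ![x 0 * Real.cosh t - x 1 * Real.sinh t, x 1 * Real.cosh t - x 0 * Real.sinh t]

variable (t : ℝ) (x y : Fin 2 → ℝ)

lemma boost_apply_zero : boost t x 0 = x 0 * Real.cosh t - x 1 * Real.sinh t := rfl

lemma boost_apply_one : boost t x 1 = x 1 * Real.cosh t - x 0 * Real.sinh t := rfl

lemma B₁_tangentVec : B₁ (tangentVec t) x = boost t x 0 := by
  rw [B₁, tangentVec, boost_apply_zero]
  simp only [Matrix.cons_val_zero, Matrix.cons_val_one]
  ring

lemma B₁_coneVec : B₁ (coneVec t) x = -√2 * boost t x 1 := by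
  rw [B₁, coneVec, boost_apply_one]
  simp only [Matrix.cons_val_zero, Matrix.cons_val_one]
  ring

lemma B₁_boost_boost : B₁ (boost t x) (boost t y) = B₁ x y := by
  simp only [B₁, boost_apply_zero, boost_apply_one]
  linear_combination (x 0 * y 0 - x 1 * y 1) * Real.cosh_sq_sub_sinh_sq t

lemma boost_smul (r : ℝ) : boost t (r • x) = r • boost t x := by
  ext i
  fin_cases i <;> simp [boost] <;> ring

@[fun_prop]
lemma continuous_boost : Continuous fun p : ℝ × (Fin 2 → ℝ) => boost p.1 p.2 := by
  have := Real.continuous_cosh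
  have := Real.continuous_sinh
  refine continuous_pi fun i => ?_
  fin_cases i <;> simp only [boost] <;> fun_prop

lemma measurePreserving_boost : MeasurePreserving (boost t) := by
  have hdet : (!![Real.cosh t, -Real.sinh t; -Real.sinh t, Real.cosh t]).det = 1 := by
    rw [Matrix.det_fin_two_of]
    linarith [Real.cosh_sq_sub_sinh_sq t]
  have hboost : boost t =
      Matrix.toLin' !![Real.cosh t, -Real.sinh t; -Real.sinh t, Real.cosh t] := by
    ext x i
    fin_cases i <;> simp [boost, Matrix.vecHead, Matrix.vecTail] <;> ring
  refine ⟨Continuous.measurable (by fun_prop), ?_⟩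
  rw [hboost, Real.map_matrix_volume_pi_eq_smul_volume_pi (hdet ▸ one_ne_zero), hdet, inv_one,
    abs_one, ENNReal.ofReal_one, one_smul]

lemma exp_mul_sum_sq_le_sum_sq_boost {T : ℝ} (ht : |t| ≤ T) :
    Real.exp (-(2 * T)) * ∑ i, x i ^ 2 ≤ ∑ i, boost t x i ^ 2 := by
  obtain ⟨hT, hT'⟩ := abs_le.mp ht
  -- The light-cone coordinates `x 0 ± x 1` are eigenvectors of `boost t`.
  have hlight : boost t x 0 ^ 2 + boost t x 1 ^ 2 =
      1 / 2 * ((x 0 + x 1) ^ 2 * Real.exp (-(2 * t)) + (x 0 - x 1) ^ 2 * Real.exp (2 * t)) := by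
    rw [boost_apply_zero, boost_apply_one, show -(2 * t) = -t + -t by ring,
      show 2 * t = t + t by ring, Real.exp_add, Real.exp_add, Real.cosh_eq, Real.sinh_eq]
    ring
  have hneg : Real.exp (-(2 * T)) ≤ Real.exp (-(2 * t)) := Real.exp_le_exp.mpr (by linarith)
  have hpos : Real.exp (-(2 * T)) ≤ Real.exp (2 * t) := Real.exp_le_exp.mpr (by linarith)
  rw [Fin.sum_univ_two, Fin.sum_univ_two, hlight]
  linarith [mul_le_mul_of_nonneg_left hneg (sq_nonneg (x 0 + x 1)),
    mul_le_mul_of_nonneg_left hpos (sq_nonneg (x 0 - x 1))]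

end Boost

section PlaneFourier

open MeasureTheory
open scoped FourierTransform

/-- The Fourier transform on the plane with respect to the form `B₁`. -/
def planeFourier (F : (Fin 2 → ℝ) → ℂ) (ζ : Fin 2 → ℝ) : ℂ :=
  ∫ x, 𝐞 (-B₁ x ζ) • F x

/-- Negation of the second coordinate, which intertwines `B₁` with the dot product. -/
def reflect {R : Type*} [Neg R] (x : Fin 2 → R) : Fin 2 → R := ![x 0, -x 1]

lemma reflect_involutive {R : Type*} [InvolutiveNeg R] :
    Function.Involutive (reflect : (Fin 2 → R) → Fin 2 → R) := fun x => by
  ext i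
  fin_cases i <;> simp [reflect]

lemma B₁_eq_dotProduct_reflect (x y : Fin 2 → ℝ) : B₁ x y = x ⬝ᵥ reflect y := by
  simp [B₁, reflect, dotProduct, sub_eq_add_neg]

lemma planeFourier_eq_piFourier (F : (Fin 2 → ℝ) → ℂ) (ζ : Fin 2 → ℝ) :
    planeFourier F ζ = piFourier F (reflect ζ) := by
  simp only [planeFourier, piFourier, B₁_eq_dotProduct_reflect]

lemma latticePoint_sub_reflect (k : Fin 2 → ℤ) (b : Fin 2 → ℝ) :
    latticePoint k - reflect b = reflect (-b + latticePoint (reflect k)) := by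
  ext i
  fin_cases i
  · simp [reflect, latticePoint, sub_eq_neg_add]
  · simp [reflect, latticePoint, sub_eq_add_neg]

lemma dotProduct_latticePoint (a b : Fin 2 → ℝ) (k : Fin 2 → ℤ) :
    a ⬝ᵥ latticePoint k = B₁ a b + B₁ (-b + latticePoint (reflect k)) a := by
  simp only [B₁, reflect, latticePoint, dotProduct, Fin.sum_univ_two, Pi.add_apply, Pi.neg_apply,
    Matrix.cons_val_zero, Matrix.cons_val_one, Int.cast_neg]
  ring

theorem tsum_fourierChar_B₁_smul {F : (Fin 2 → ℝ) → ℂ} (hF : Continuous F) {A ε : ℝ} (hε : 0 < ε)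
    (hb : ∀ x, ‖F x‖ ≤ A * gaussianWeight ε x) (a b : Fin 2 → ℝ)
    (hs : Summable fun l : Fin 2 → ℤ =>
      𝐞 (B₁ (-b + latticePoint l) a) • planeFourier F (-b + latticePoint l)) :
    ∑' l : Fin 2 → ℤ, 𝐞 (B₁ (a + latticePoint l) b) • F (a + latticePoint l) =
      𝐞 (B₁ a b) • ∑' l : Fin 2 → ℤ,
        𝐞 (B₁ (-b + latticePoint l) a) • planeFourier F (-b + latticePoint l) := by
  let e : (Fin 2 → ℤ) ≃ (Fin 2 → ℤ) := reflect_involutive.toPerm reflect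
  let G : (Fin 2 → ℤ) → ℂ := fun l =>
    𝐞 (B₁ (-b + latticePoint l) a) • planeFourier F (-b + latticePoint l)
  have hterm : ∀ k : Fin 2 → ℤ, 𝐞 (a ⬝ᵥ latticePoint k) •
      piFourier F (latticePoint k - reflect b) = (𝐞 (B₁ a b) : ℂ) * G (e k) := by
    intro k
    rw [latticePoint_sub_reflect, ← planeFourier_eq_piFourier, dotProduct_latticePoint a b,
      AddChar.map_add_eq_mul, mul_smul, Circle.smul_def, smul_eq_mul]
    rfl
  simp only [B₁_eq_dotProduct_reflect _ b]
  rw [tsum_fourierChar_smul_add_latticePoint hF hε hb a (reflect b)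
    (by simp only [hterm]; exact (hs.comp_injective e.injective).mul_left _)]
  simp only [hterm, Circle.smul_def]
  rw [tsum_mul_left, e.tsum_eq G, ← B₁_eq_dotProduct_reflect, smul_eq_mul]
  rfl

lemma planeFourier_comp_boost {F : (Fin 2 → ℝ) → ℂ} (hF : Continuous F) (t : ℝ)
    (ζ : Fin 2 → ℝ) :
    planeFourier (fun x => F (boost t x)) ζ = planeFourier F (boost t ζ) := by
  have hcont : Continuous fun y => 𝐞 (-B₁ y (boost t ζ)) • F y := by
    simp only [B₁_eq_dotProduct_reflect]
    exact (Real.continuous_fourierChar.comp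
      (Continuous.dotProduct continuous_id continuous_const).neg).smul hF
  have hmp := measurePreserving_boost t
  rw [planeFourier, planeFourier, ← hmp.map_eq,
    integral_map hmp.aemeasurable hcont.aestronglyMeasurable]
  simp only [B₁_boost_boost]
  rw [hmp.map_eq]

lemma planeFourier_mul (f g : ℝ → ℂ) (ζ : Fin 2 → ℝ) :
    planeFourier (fun x => f (x 0) * g (x 1)) ζ = 𝓕 f (ζ 0) * 𝓕 g (-ζ 1) := by
  have h := integral_fintype_prod_volume_eq_prod (ι := Fin 2) (𝕜 := ℂ) (E := fun _ => ℝ)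
    ![fun u => 𝐞 (-(u * ζ 0)) • f u, fun u => 𝐞 (-(u * -ζ 1)) • g u]
  simp only [Fin.prod_univ_two, Matrix.cons_val_zero, Matrix.cons_val_one] at h
  rw [Real.fourier_real_eq, Real.fourier_real_eq, ← h, planeFourier]
  refine integral_congr_ae (Filter.Eventually.of_forall fun x => ?_)
  simp only [smul_mul_smul_comm, ← AddChar.map_add_eq_mul, B₁]
  congr 2
  ring

end PlaneFourier

section HermiteFourier

open MeasureTheory Polynomial
open scoped FourierTransform ComplexConjugate

/-! ### Hermite functions -/

lemma exists_norm_eval_le (p : ℂ[X]) {δ : ℝ} (hδ : 0 < δ) :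
    ∃ A : ℝ, 0 ≤ A ∧ ∀ u : ℝ, ‖p.eval (u : ℂ)‖ ≤ A * Real.exp (δ * u ^ 2) := by
  induction p using Polynomial.induction_on' with
  | add p q hp hq =>
    obtain ⟨A, hA, hp⟩ := hp
    obtain ⟨B, hB, hq⟩ := hq
    refine ⟨A + B, by positivity, fun u => ?_⟩
    rw [eval_add, add_mul]
    exact (norm_add_le _ _).trans (add_le_add (hp u) (hq u))
  | monomial n a =>
    refine ⟨‖a‖ * (1 + n.factorial / δ ^ n), by positivity, fun u => ?_⟩
    rw [eval_monomial, norm_mul, norm_pow, Complex.norm_real, mul_assoc, Real.norm_eq_abs]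
    refine mul_le_mul_of_nonneg_left ?_ (norm_nonneg _)
    have hexp := Real.pow_div_factorial_le_exp (δ * u ^ 2) (by positivity) n
    have hone : 1 ≤ Real.exp (δ * u ^ 2) := Real.one_le_exp (by positivity)
    have hsq : |u| ^ n ≤ 1 + (u ^ 2) ^ n := by
      rw [← sq_abs u, ← pow_mul, mul_comm 2 n, pow_mul]
      nlinarith [sq_nonneg (|u| ^ n - 1), pow_nonneg (abs_nonneg u) n]
    have hpow : (u ^ 2) ^ n ≤ n.factorial / δ ^ n * Real.exp (δ * u ^ 2) := by
      rw [mul_pow, div_le_iff₀ (by positivity)] at hexp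
      rw [div_mul_eq_mul_div, le_div_iff₀ (by positivity)]
      linarith
    linarith

/-- The Gaussian `exp (π i τ u ^ 2)`. -/
def gaussian (τ : ℂ) (u : ℝ) : ℂ := Complex.exp (Real.pi * Complex.I * τ * (u : ℂ) ^ 2)

/-- The polynomial `p` times the Gaussian of parameter `τ`. -/
def polyGaussian (p : ℂ[X]) (τ : ℂ) (u : ℝ) : ℂ := p.eval (u : ℂ) * gaussian τ u

/-- The Hermite function `u ↦ H_n (√v u) exp (π i τ u ^ 2)`, where `v = Im τ`. -/
def hermiteFun (n : ℕ) (τ : ℂ) : ℝ → ℂ :=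
  polyGaussian ((hermitePoly n).comp (C (√τ.im : ℂ) * X)) τ

/-- The raising operator on functions of a real variable, which takes each Hermite function of
parameter `τ` to the next one. -/
def raise (τ : ℂ) (f : ℝ → ℂ) (u : ℝ) : ℂ :=
  1 / (2 * √τ.im) * (Complex.I * conj τ * (u * f u) - 1 / (2 * Real.pi) * deriv f u)

lemma norm_gaussian (τ : ℂ) (u : ℝ) : ‖gaussian τ u‖ = Real.exp (-(Real.pi * τ.im) * u ^ 2) := by
  have hre : Real.pi * Complex.I * τ * (u : ℂ) ^ 2 =
      ((Real.pi * u ^ 2 : ℝ) : ℂ) * (Complex.I * τ) := by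
    push_cast
    ring
  rw [gaussian, Complex.norm_exp, hre, Complex.re_ofReal_mul, Complex.I_mul_re]
  congr 1
  ring

@[fun_prop]
lemma continuous_gaussian (τ : ℂ) : Continuous (gaussian τ) := by
  unfold gaussian
  fun_prop

@[fun_prop]
lemma continuous_polyGaussian (p : ℂ[X]) (τ : ℂ) : Continuous (polyGaussian p τ) := by
  unfold polyGaussian
  fun_prop

lemma hermiteFun_apply (n : ℕ) (τ : ℂ) (u : ℝ) :
    hermiteFun n τ u = (hermitePoly n).eval ((√τ.im * u : ℝ) : ℂ) * gaussian τ u := by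
  simp [hermiteFun, polyGaussian]

lemma hermiteFun_zero (τ : ℂ) : hermiteFun 0 τ = gaussian τ := by
  ext u
  simp [hermiteFun_apply, hermitePoly]

lemma mul_polyGaussian (p : ℂ[X]) (τ : ℂ) (u : ℝ) :
    (u : ℂ) * polyGaussian p τ u = polyGaussian (X * p) τ u := by
  rw [polyGaussian, polyGaussian, eval_mul, eval_X, mul_assoc]

lemma hasDerivAt_polyGaussian (p : ℂ[X]) (τ : ℂ) (u : ℝ) :
    HasDerivAt (polyGaussian p τ)
      (polyGaussian (derivative p + C (2 * Real.pi * Complex.I * τ) * X * p) τ u) u := by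
  have hp : HasDerivAt (fun u : ℝ => p.eval (u : ℂ)) ((derivative p).eval (u : ℂ)) u :=
    (p.hasDerivAt (u : ℂ)).comp_ofReal
  have hg : HasDerivAt (gaussian τ) (gaussian τ u * (Real.pi * Complex.I * τ * (2 * u))) u := by
    have h := (((hasDerivAt_id u).ofReal_comp.pow 2).const_mul (Real.pi * Complex.I * τ)).cexp
    exact h.congr_deriv (by simp [gaussian])
  refine (hp.mul hg).congr_deriv ?_
  simp only [polyGaussian, eval_add, eval_mul, eval_C, eval_X]
  ring

lemma deriv_polyGaussian (p : ℂ[X]) (τ : ℂ) :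
    deriv (polyGaussian p τ) =
      polyGaussian (derivative p + C (2 * Real.pi * Complex.I * τ) * X * p) τ :=
  funext fun u => (hasDerivAt_polyGaussian p τ u).deriv

lemma hermiteFun_succ (n : ℕ) {τ : ℂ} (hτ : 0 < τ.im) :
    hermiteFun (n + 1) τ = raise τ (hermiteFun n τ) := by
  ext u
  have hs : (√τ.im : ℂ) ≠ 0 := Complex.ofReal_ne_zero.mpr (Real.sqrt_pos.mpr hτ).ne'
  have hpi : (Real.pi : ℂ) ≠ 0 := Complex.ofReal_ne_zero.mpr Real.pi_ne_zero
  have hconj : Complex.I * conj τ = Complex.I * τ + 2 * (√τ.im : ℂ) ^ 2 := by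
    rw [← Complex.ofReal_pow, Real.sq_sqrt hτ.le]
    apply Complex.ext <;> simp
    ring
  rw [raise, hconj, hermiteFun, hermiteFun, deriv_polyGaussian, hermitePoly]
  simp only [polyGaussian, derivative_comp, derivative_C_mul, derivative_X, eval_comp, eval_add,
    eval_sub, eval_mul, eval_X, eval_C, eval_one]
  field_simp
  ring

lemma integrable_polyGaussian (p : ℂ[X]) {τ : ℂ} (hτ : 0 < τ.im) :
    Integrable (polyGaussian p τ) := by
  have hpos : 0 < Real.pi * τ.im / 2 := half_pos (mul_pos Real.pi_pos hτ)
  obtain ⟨A, -, h⟩ := exists_norm_eval_le p hpos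
  refine ((integrable_exp_neg_mul_sq hpos).const_mul A).mono' (by fun_prop)
    (Filter.Eventually.of_forall fun u => ?_)
  rw [polyGaussian, norm_mul, norm_gaussian]
  refine (mul_le_mul_of_nonneg_right (h u) (Real.exp_nonneg _)).trans_eq ?_
  rw [mul_assoc, ← Real.exp_add]
  congr 2
  ring

/-! ### Fourier transforms of Hermite functions -/

lemma ne_zero_of_im_pos {τ : ℂ} (hτ : 0 < τ.im) : τ ≠ 0 := by
  rintro rfl
  exact hτ.false

lemma neg_one_div_im (τ : ℂ) : (-1 / τ).im = τ.im / ‖τ‖ ^ 2 := by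
  rw [neg_div, one_div, Complex.neg_im, Complex.inv_im, Complex.normSq_eq_norm_sq, neg_div,
    neg_neg]

lemma neg_one_div_im_pos {τ : ℂ} (hτ : 0 < τ.im) : 0 < (-1 / τ).im := by
  rw [neg_one_div_im]
  exact div_pos hτ (pow_pos (norm_pos_iff.mpr (ne_zero_of_im_pos hτ)) 2)

lemma sqrt_neg_one_div_im (τ : ℂ) : √(-1 / τ).im = √τ.im / ‖τ‖ := by
  rw [neg_one_div_im, Real.sqrt_div' _ (by positivity), Real.sqrt_sq (norm_nonneg _)]

lemma fourier_mul_add_deriv {f : ℝ → ℂ} (hf : Integrable f)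
    (hxf : Integrable fun u : ℝ => (u : ℂ) * f u) (hdiff : Differentiable ℝ f)
    (hderiv : Integrable (deriv f)) (α β : ℂ) (ξ : ℝ) :
    𝓕 (fun u : ℝ => α * (-2 * Real.pi * Complex.I * u * f u) + β * deriv f u) ξ =
      α * deriv (𝓕 f) ξ + β * (2 * Real.pi * Complex.I * ξ * 𝓕 f ξ) := by
  have hint : ∀ {g : ℝ → ℂ}, Integrable g → Integrable fun u : ℝ => 𝐞 (-(u * ξ)) • g u :=
    fun hg => hg.norm.mono' ((by fun_prop : Continuous fun u : ℝ =>
      (𝐞 (-(u * ξ)))).aestronglyMeasurable.smul hg.1)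
      (Filter.Eventually.of_forall fun _ => (Circle.norm_smul _ _).le)
  have hmul : Integrable fun u : ℝ => -2 * Real.pi * Complex.I * u * f u := by
    simpa only [mul_assoc] using hxf.const_mul (-2 * Real.pi * Complex.I)
  have hfd := congrFun (Real.fourier_deriv hf hdiff hderiv) ξ
  rw [Real.deriv_fourier hf (by simpa only [Complex.real_smul] using hxf)]
  simp only [smul_eq_mul] at hfd ⊢
  rw [← hfd, Real.fourier_real_eq, Real.fourier_real_eq, Real.fourier_real_eq,
    ← integral_const_mul, ← integral_const_mul,
    ← integral_add ((hint hmul).const_mul α) ((hint hderiv).const_mul β)]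
  refine integral_congr_ae (Filter.Eventually.of_forall fun u => ?_)
  simp only [Circle.smul_def, smul_eq_mul]
  ring

lemma fourier_raise {τ : ℂ} (hτ : 0 < τ.im) {f : ℝ → ℂ} (hf : Integrable f)
    (hxf : Integrable fun u : ℝ => (u : ℂ) * f u) (hdiff : Differentiable ℝ f)
    (hderiv : Integrable (deriv f)) :
    𝓕 (raise τ f) = (conj τ / ‖τ‖) • raise (-1 / τ) (𝓕 f) := by
  have hconj : conj τ ≠ 0 := (_root_.map_ne_zero _).mpr (ne_zero_of_im_pos hτ)
  have hnorm : (‖τ‖ : ℂ) ≠ 0 :=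
    Complex.ofReal_ne_zero.mpr (norm_pos_iff.mpr (ne_zero_of_im_pos hτ)).ne'
  have hpi : (Real.pi : ℂ) ≠ 0 := Complex.ofReal_ne_zero.mpr Real.pi_ne_zero
  have hs : (√τ.im : ℂ) ≠ 0 := Complex.ofReal_ne_zero.mpr (Real.sqrt_pos.mpr hτ).ne'
  have hraise : raise τ f = fun u : ℝ =>
      -conj τ / (4 * Real.pi * √τ.im) * (-2 * Real.pi * Complex.I * u * f u)
        + -1 / (4 * Real.pi * √τ.im) * deriv f u := by
    ext u
    rw [raise]
    field_simp
    ring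
  ext ξ
  rw [hraise, fourier_mul_add_deriv hf hxf hdiff hderiv, Pi.smul_apply, raise,
    sqrt_neg_one_div_im, map_div₀, map_neg, map_one, Complex.ofReal_div, smul_eq_mul]
  field_simp
  ring

lemma raise_smul (τ c : ℂ) (f : ℝ → ℂ) : raise τ (c • f) = c • raise τ f := by
  ext u
  rw [Pi.smul_apply, raise, raise, deriv_const_smul_field, Pi.smul_apply, smul_eq_mul, smul_eq_mul,
    smul_eq_mul]
  ring

lemma fourier_gaussian {τ : ℂ} (hτ : 0 < τ.im) :
    𝓕 (gaussian τ) = (1 / (-Complex.I * τ) ^ (1 / 2 : ℂ)) • gaussian (-1 / τ) := by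
  have hne := ne_zero_of_im_pos hτ
  have hgauss : gaussian τ =
      fun u : ℝ => Complex.exp (-Real.pi * (-Complex.I * τ) * (u : ℂ) ^ 2) := by
    ext u
    rw [gaussian]
    congr 1
    ring
  rw [hgauss, fourier_gaussian_pi (by simpa using hτ)]
  ext ξ
  rw [Pi.smul_apply, gaussian, smul_eq_mul]
  congr 2
  field_simp
  rw [Complex.I_sq]
  ring

theorem fourier_hermiteFun (n : ℕ) {τ : ℂ} (hτ : 0 < τ.im) :
    𝓕 (hermiteFun n τ) =
      (1 / (-Complex.I * τ) ^ (1 / 2 : ℂ) * (conj τ / ‖τ‖) ^ n) • hermiteFun n (-1 / τ) := by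
  induction n with
  | zero => rw [hermiteFun_zero, hermiteFun_zero, fourier_gaussian hτ, pow_zero, mul_one]
  | succ n ih =>
    have hf : Integrable (hermiteFun n τ) := integrable_polyGaussian _ hτ
    have hxf : Integrable fun u : ℝ => (u : ℂ) * hermiteFun n τ u := by
      simp only [hermiteFun, mul_polyGaussian]
      exact integrable_polyGaussian _ hτ
    have hderiv : Integrable (deriv (hermiteFun n τ)) := by
      rw [hermiteFun, deriv_polyGaussian]
      exact integrable_polyGaussian _ hτ
    have hdiff : Differentiable ℝ (hermiteFun n τ) := fun u =>
      (hasDerivAt_polyGaussian _ τ u).differentiableAt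
    rw [hermiteFun_succ n hτ, fourier_raise hτ hf hxf hdiff hderiv, ih,
      raise_smul, ← hermiteFun_succ n (neg_one_div_im_pos hτ), smul_smul]
    congr 1
    ring

lemma cpow_half_mul_cpow_half_conj {τ : ℂ} (hτ : 0 < τ.im) :
    (-Complex.I * τ) ^ (1 / 2 : ℂ) * (-Complex.I * -conj τ) ^ (1 / 2 : ℂ) = (‖τ‖ : ℂ) := by
  have hre : 0 < (-Complex.I * τ).re := by simpa using hτ
  have harg : (-Complex.I * τ).arg ≠ Real.pi := fun h =>
    hre.not_gt (Complex.arg_eq_pi_iff.mp h).1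
  have hconj : (-Complex.I * -conj τ) ^ (1 / 2 : ℂ) = conj ((-Complex.I * τ) ^ (1 / 2 : ℂ)) := by
    have h := Complex.conj_cpow (-Complex.I * τ) (1 / 2) harg
    rwa [map_mul, map_neg, Complex.conj_I, neg_neg, ← neg_mul_neg, map_div₀, map_one,
      map_ofNat] at h
  have hnorm : ‖(-Complex.I * τ) ^ (1 / 2 : ℂ)‖ = √‖τ‖ := by
    have h := Complex.norm_cpow_real (-Complex.I * τ) (1 / 2 : ℝ)
    rw [← Real.sqrt_eq_rpow, norm_mul, norm_neg, Complex.norm_I, one_mul] at h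
    simpa using h
  rw [hconj, Complex.mul_conj, Complex.normSq_eq_norm_sq, hnorm, Real.sq_sqrt (norm_nonneg _)]

end HermiteFourier

section BoostedHermite

open scoped FourierTransform ComplexConjugate

/-! ### Lattice sums of boosted Hermite functions -/

/-- The Hermite function of parameter `τ` in the positive direction of `B₁` times the Gaussian of
parameter `-conj τ` in the negative one. -/
def planeHermite (n : ℕ) (τ : ℂ) (x : Fin 2 → ℝ) : ℂ :=
  hermiteFun n τ (x 0) * gaussian (-conj τ) (x 1)

@[fun_prop]
lemma continuous_planeHermite (n : ℕ) (τ : ℂ) : Continuous (planeHermite n τ) := by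
  unfold planeHermite hermiteFun
  fun_prop

lemma exists_norm_planeHermite_le (n : ℕ) {τ : ℂ} (hτ : 0 < τ.im) :
    ∃ A ε : ℝ, 0 ≤ A ∧ 0 < ε ∧ ∀ x, ‖planeHermite n τ x‖ ≤ A * gaussianWeight ε x := by
  obtain ⟨A, hA, hH⟩ := exists_norm_eval_le (hermitePoly n) (half_pos Real.pi_pos)
  have hε : 0 < Real.pi * τ.im / 2 := half_pos (mul_pos Real.pi_pos hτ)
  refine ⟨A, Real.pi * τ.im / 2, hA, hε, fun x => ?_⟩
  rw [planeHermite, hermiteFun_apply, norm_mul, norm_mul, norm_gaussian, norm_gaussian,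
    gaussianWeight, Complex.neg_im, Complex.conj_im, neg_neg, Fin.sum_univ_two]
  refine (mul_le_mul_of_nonneg_right (mul_le_mul_of_nonneg_right (hH _) (Real.exp_nonneg _))
    (Real.exp_nonneg _)).trans ?_
  rw [mul_assoc, mul_assoc, ← Real.exp_add, ← Real.exp_add, mul_pow, Real.sq_sqrt hτ.le]
  refine mul_le_mul_of_nonneg_left (Real.exp_le_exp.mpr ?_) hA
  linarith [mul_nonneg hε.le (sq_nonneg (x 1))]

lemma gaussianWeight_boost_le {ε : ℝ} (hε : 0 ≤ ε) {t T : ℝ} (ht : |t| ≤ T) (x : Fin 2 → ℝ) :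
    gaussianWeight ε (boost t x) ≤ gaussianWeight (ε * Real.exp (-(2 * T))) x := by
  rw [gaussianWeight, gaussianWeight, Real.exp_le_exp, neg_mul, neg_mul, neg_le_neg_iff, mul_assoc]
  exact mul_le_mul_of_nonneg_left (exp_mul_sum_sq_le_sum_sq_boost t x ht) hε

lemma exists_norm_planeHermite_boost_le (n : ℕ) {τ : ℂ} (hτ : 0 < τ.im) (T : ℝ) :
    ∃ A ε : ℝ, 0 < ε ∧ ∀ t, |t| ≤ T → ∀ x,
      ‖planeHermite n τ (boost t x)‖ ≤ A * gaussianWeight ε x := by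
  obtain ⟨A, ε, hA, hε, hb⟩ := exists_norm_planeHermite_le n hτ
  exact ⟨A, ε * Real.exp (-(2 * T)), by positivity, fun t ht x =>
    (hb _).trans (mul_le_mul_of_nonneg_left (gaussianWeight_boost_le hε.le ht x) hA)⟩

lemma exists_summable_norm_planeHermite_le (n : ℕ) {τ : ℂ} (hτ : 0 < τ.im) (T : ℝ)
    (a : Fin 2 → ℝ) :
    ∃ u : (Fin 2 → ℤ) → ℝ, Summable u ∧ ∀ t, |t| ≤ T → ∀ l,
      ‖planeHermite n τ (boost t (a + latticePoint l))‖ ≤ u l := by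
  obtain ⟨A, ε, hε, hb⟩ := exists_norm_planeHermite_boost_le n hτ T
  exact ⟨_, (summable_gaussianWeight_latticePoint (half_pos hε)).mul_left _, fun t ht l =>
    norm_add_latticePoint_le hε.le (hb t ht) (fun i => norm_le_pi_norm a i) l⟩

lemma summable_planeHermite_boost (n : ℕ) {τ : ℂ} (hτ : 0 < τ.im) (t : ℝ) (a b : Fin 2 → ℝ) :
    Summable fun l : Fin 2 → ℤ => 𝐞 (B₁ (a + latticePoint l) b) •
      planeHermite n τ (boost t (a + latticePoint l)) := by
  obtain ⟨u, hu, hle⟩ := exists_summable_norm_planeHermite_le n hτ |t| a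
  exact Summable.of_norm_bounded hu fun l => (Circle.norm_smul _ _).trans_le (hle t le_rfl l)

lemma gaussian_neg (τ : ℂ) (u : ℝ) : gaussian τ (-u) = gaussian τ u := by
  rw [gaussian, gaussian, Complex.ofReal_neg, neg_sq]

lemma planeFourier_planeHermite (n : ℕ) {τ : ℂ} (hτ : 0 < τ.im) :
    planeFourier (planeHermite n τ) =
      (1 / ‖τ‖ * (conj τ / ‖τ‖) ^ n : ℂ) • planeHermite n (-1 / τ) := by
  ext ζ
  have hconj : 0 < (-conj τ).im := by simpa using hτ
  have hinv : -1 / -conj τ = -conj (-1 / τ) := by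
    rw [map_div₀, map_neg, map_one, div_neg]
  refine (planeFourier_mul (hermiteFun n τ) (gaussian (-conj τ)) ζ).trans ?_
  rw [fourier_hermiteFun n hτ, fourier_gaussian hconj, hinv, Pi.smul_apply, Pi.smul_apply,
    Pi.smul_apply, gaussian_neg, planeHermite, ← cpow_half_mul_cpow_half_conj hτ]
  simp only [smul_eq_mul, one_div, mul_inv]
  ring

lemma planeFourier_planeHermite_neg_one_div (n : ℕ) {τ : ℂ} (hτ : 0 < τ.im) :
    planeFourier (planeHermite n (-1 / τ)) =
      (‖τ‖ * (-τ / ‖τ‖) ^ n : ℂ) • planeHermite n τ := by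
  have hne := ne_zero_of_im_pos hτ
  have hconj : conj τ ≠ 0 := (map_ne_zero _).mpr hne
  have hnorm : (‖τ‖ : ℂ) ≠ 0 := Complex.ofReal_ne_zero.mpr (norm_pos_iff.mpr hne).ne'
  have hphase : conj (-1 / τ) / (‖-1 / τ‖ : ℂ) = -τ / ‖τ‖ := by
    rw [map_div₀, map_neg, map_one, norm_div, norm_neg, norm_one, Complex.ofReal_div,
      Complex.ofReal_one]
    field_simp
    rw [← Complex.conj_mul']
  rw [planeFourier_planeHermite n (neg_one_div_im_pos hτ), hphase, norm_div, norm_neg, norm_one,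
    Complex.ofReal_div, Complex.ofReal_one, one_div_one_div, div_div_eq_mul_div]
  congr 2
  field_simp

theorem tsum_planeHermite_boost_neg_one_div (n : ℕ) {τ : ℂ} (hτ : 0 < τ.im) (t : ℝ)
    (a b : Fin 2 → ℝ) :
    ∑' l : Fin 2 → ℤ, 𝐞 (B₁ (a + latticePoint l) b) •
        planeHermite n (-1 / τ) (boost t (a + latticePoint l)) =
      𝐞 (B₁ a b) • (‖τ‖ * (-τ / ‖τ‖) ^ n * ∑' l : Fin 2 → ℤ,
        𝐞 (B₁ (-b + latticePoint l) a) • planeHermite n τ (boost t (-b + latticePoint l))) := by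
  obtain ⟨A, ε, hε, hb⟩ := exists_norm_planeHermite_boost_le n (neg_one_div_im_pos hτ) |t|
  have hfourier : ∀ ζ, planeFourier (fun x => planeHermite n (-1 / τ) (boost t x)) ζ =
      ‖τ‖ * (-τ / ‖τ‖) ^ n * planeHermite n τ (boost t ζ) := by
    intro ζ
    rw [planeFourier_comp_boost (continuous_planeHermite _ _),
      planeFourier_planeHermite_neg_one_div n hτ, Pi.smul_apply, smul_eq_mul]
  have hterm : ∀ l : Fin 2 → ℤ, 𝐞 (B₁ (-b + latticePoint l) a) •
      planeFourier (fun x => planeHermite n (-1 / τ) (boost t x)) (-b + latticePoint l) =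
        ‖τ‖ * (-τ / ‖τ‖) ^ n * 𝐞 (B₁ (-b + latticePoint l) a) •
          planeHermite n τ (boost t (-b + latticePoint l)) := fun l => by
    rw [hfourier, mul_smul_comm]
  rw [tsum_fourierChar_B₁_smul (by fun_prop) hε (hb t le_rfl)]
  · simp only [hterm, tsum_mul_left]
  · simpa only [hterm] using (summable_planeHermite_boost n hτ t (-b) a).mul_left _

end BoostedHermite

section PlaneTheta

open MeasureTheory
open scoped FourierTransform ComplexConjugate

/-! ### Theta series of a plane -/

/-- The density against which `planeTerm` integrates boosted Hermite functions between the two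
cone angles. -/
def hyperbolicWeight (i k : ℕ) (s : ℝ) : ℝ := 2 * √2 * (Real.cosh s ^ i * Real.sinh s ^ k)

/-- The summand of the theta series of a plane attached to the monomial `x ^ i * y ^ k`. -/
def planeTerm (t₀ t₁ : ℝ) (i k : ℕ) (b : Fin 2 → ℝ) (τ : ℂ) (x : Fin 2 → ℝ) : ℂ :=
  𝐞 (B₁ x b) • (planeKernel t₀ t₁ i k (√τ.im • x) *
    Complex.exp (2 * (Real.pi : ℂ) * Complex.I * τ * (Q₁ x : ℂ)))

/-- The theta series of a plane attached to the monomial `x ^ i * y ^ k`. -/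
def planeTheta (t₀ t₁ : ℝ) (i k : ℕ) (a b : Fin 2 → ℝ) (τ : ℂ) : ℂ :=
  ∑' l : Fin 2 → ℤ, planeTerm t₀ t₁ i k b τ (a + latticePoint l)

@[fun_prop]
lemma continuous_hyperbolicWeight (i k : ℕ) : Continuous (hyperbolicWeight i k) := by
  have := Real.continuous_cosh
  have := Real.continuous_sinh
  unfold hyperbolicWeight
  fun_prop

lemma Q₁_eq_boost (t : ℝ) (x : Fin 2 → ℝ) :
    Q₁ x = 1 / 2 * (boost t x 0 ^ 2 - boost t x 1 ^ 2) := by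
  rw [Q₁, boost_apply_zero, boost_apply_one]
  linear_combination (-(1 / 2) * (x 0 ^ 2 - x 1 ^ 2)) * Real.cosh_sq_sub_sinh_sq t

lemma deriv_E_mul_exp_eq_planeHermite (n : ℕ) (s : ℝ) {τ : ℂ} (hτ : 0 < τ.im)
    (x : Fin 2 → ℝ) :
    (hermitePoly n).eval (B₁ (tangentVec s) (√τ.im • x) : ℂ) *
          ((deriv E (B₁ (coneVec s) (√τ.im • x)) : ℝ) : ℂ) *
        Complex.exp (2 * (Real.pi : ℂ) * Complex.I * τ * (Q₁ x : ℂ)) =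
      2 * planeHermite n τ (boost s x) := by
  have hsq : (-√2 * (√τ.im * boost s x 1)) ^ 2 = 2 * τ.im * boost s x 1 ^ 2 := by
    rw [mul_pow, mul_pow, neg_sq, Real.sq_sqrt zero_le_two, Real.sq_sqrt hτ.le, mul_assoc]
  have hderiv : ∀ z, deriv E z = 2 * Real.exp (-Real.pi * z ^ 2) := congrFun deriv_E
  have hconj : conj τ = τ - 2 * Complex.I * (τ.im : ℂ) := by
    apply Complex.ext <;> simp
    ring
  rw [B₁_tangentVec, B₁_coneVec, boost_smul, Pi.smul_apply, Pi.smul_apply, smul_eq_mul,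
    smul_eq_mul, hderiv, planeHermite, hermiteFun_apply, gaussian, gaussian, hsq,
    Q₁_eq_boost s x, hconj, mul_assoc (Polynomial.eval _ _), mul_assoc (Polynomial.eval _ _),
    ← Complex.exp_add, Complex.ofReal_mul 2, Complex.ofReal_exp, Complex.ofReal_ofNat, mul_assoc 2,
    ← Complex.exp_add, mul_left_comm 2]
  congr 3
  push_cast
  linear_combination (-2 * (Real.pi : ℂ) * τ.im * (boost s x 1 : ℂ) ^ 2) * Complex.I_sq

lemma hasDerivAt_coneOp_mul_exp (i k : ℕ) {τ : ℂ} (hτ : 0 < τ.im) (s : ℝ) (x : Fin 2 → ℝ) :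
    HasDerivAt (fun s => coneOp 0 (coneVec s) (√τ.im • x) (hermitePlane i k) *
        Complex.exp (2 * (Real.pi : ℂ) * Complex.I * τ * (Q₁ x : ℂ)))
      (hyperbolicWeight i k s * planeHermite (i + k + 1) τ (boost s x)) s := by
  refine ((hasDerivAt_coneOp_hermitePlane i k s _).mul_const _).congr_deriv ?_
  rw [mul_assoc, deriv_E_mul_exp_eq_planeHermite _ _ hτ, hyperbolicWeight]
  push_cast
  ring

lemma planeTerm_eq_integral (t₀ t₁ : ℝ) (i k : ℕ) (b : Fin 2 → ℝ) {τ : ℂ} (hτ : 0 < τ.im)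
    (x : Fin 2 → ℝ) :
    planeTerm t₀ t₁ i k b τ x = ∫ s in t₁..t₀, (hyperbolicWeight i k s : ℂ) *
      𝐞 (B₁ x b) • planeHermite (i + k + 1) τ (boost s x) := by
  have hcont : Continuous fun s : ℝ =>
      (hyperbolicWeight i k s : ℂ) * planeHermite (i + k + 1) τ (boost s x) := by fun_prop
  simp only [mul_smul_comm, Circle.smul_def]
  rw [intervalIntegral.integral_smul, intervalIntegral.integral_eq_sub_of_hasDerivAt
    (fun s _ => hasDerivAt_coneOp_mul_exp i k hτ s x) (hcont.intervalIntegrable _ _), ← sub_mul]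
  rfl

lemma abs_le_max_abs_of_mem_uIcc {x y s : ℝ} (hs : s ∈ Set.uIcc x y) : |s| ≤ max |x| |y| := by
  refine (abs_le_max_abs_abs hs.1 hs.2).trans ?_
  rcases le_total x y with h | h <;> simp [h, max_comm]

lemma exists_summable_norm_hyperbolicWeight_mul_le (t₀ t₁ : ℝ) (i k : ℕ) (a b : Fin 2 → ℝ)
    {τ : ℂ} (hτ : 0 < τ.im) :
    ∃ u : (Fin 2 → ℤ) → ℝ, Summable u ∧ ∀ s ∈ Set.uIcc t₁ t₀, ∀ l,
      ‖(hyperbolicWeight i k s : ℂ) * 𝐞 (B₁ (a + latticePoint l) b) •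
        planeHermite (i + k + 1) τ (boost s (a + latticePoint l))‖ ≤ u l := by
  obtain ⟨u, hu, hle⟩ :=
    exists_summable_norm_planeHermite_le (i + k + 1) hτ (max |t₁| |t₀|) a
  obtain ⟨W, hW⟩ := (isCompact_uIcc (a := t₁) (b := t₀)).exists_bound_of_continuousOn
    (continuous_hyperbolicWeight i k).continuousOn
  refine ⟨fun l => W * u l, hu.mul_left W, fun s hs l => ?_⟩
  rw [norm_mul, Circle.norm_smul, Complex.norm_real]
  exact mul_le_mul (hW s hs) (hle s (abs_le_max_abs_of_mem_uIcc hs) l) (norm_nonneg _)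
    ((norm_nonneg _).trans (hW s hs))

lemma summable_norm_planeTerm (t₀ t₁ : ℝ) (i k : ℕ) (a b : Fin 2 → ℝ) {τ : ℂ} (hτ : 0 < τ.im) :
    Summable fun l : Fin 2 → ℤ => ‖planeTerm t₀ t₁ i k b τ (a + latticePoint l)‖ := by
  obtain ⟨u, hu, hle⟩ := exists_summable_norm_hyperbolicWeight_mul_le t₀ t₁ i k a b hτ
  refine Summable.of_nonneg_of_le (fun _ => norm_nonneg _) (fun l => ?_) (hu.mul_right |t₀ - t₁|)
  rw [planeTerm_eq_integral _ _ _ _ _ hτ]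
  exact intervalIntegral.norm_integral_le_of_norm_le_const fun s hs =>
    hle s (Set.uIoc_subset_uIcc hs) l

lemma planeTheta_eq_integral (t₀ t₁ : ℝ) (i k : ℕ) (a b : Fin 2 → ℝ) {τ : ℂ} (hτ : 0 < τ.im) :
    planeTheta t₀ t₁ i k a b τ = ∫ s in t₁..t₀, (hyperbolicWeight i k s : ℂ) *
      ∑' l : Fin 2 → ℤ, 𝐞 (B₁ (a + latticePoint l) b) •
        planeHermite (i + k + 1) τ (boost s (a + latticePoint l)) := by
  obtain ⟨u, hu, hle⟩ := exists_summable_norm_hyperbolicWeight_mul_le t₀ t₁ i k a b hτ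
  simp only [planeTheta, planeTerm_eq_integral _ _ _ _ _ hτ]
  refine (intervalIntegral.hasSum_integral_of_dominated_convergence (fun l _ => u l)
    (fun l => ?_) (fun l => Filter.Eventually.of_forall fun s hs =>
      hle s (Set.uIoc_subset_uIcc hs) l) (Filter.Eventually.of_forall fun _ _ => hu)
    intervalIntegrable_const (Filter.Eventually.of_forall fun s _ =>
      (summable_planeHermite_boost _ hτ s a b).hasSum.mul_left _)).tsum_eq
  simp only [Circle.smul_def]
  exact Continuous.aestronglyMeasurable (by fun_prop)

theorem planeTheta_neg_one_div (t₀ t₁ : ℝ) (i k : ℕ) (a b : Fin 2 → ℝ) {τ : ℂ}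
    (hτ : 0 < τ.im) :
    planeTheta t₀ t₁ i k a b (-1 / τ) = ‖τ‖ * (-τ / ‖τ‖) ^ (i + k + 1) * 𝐞 (B₁ a b) *
      planeTheta t₀ t₁ i k (-b) a τ := by
  rw [planeTheta_eq_integral _ _ _ _ _ _ (neg_one_div_im_pos hτ),
    planeTheta_eq_integral _ _ _ _ _ _ hτ, ← intervalIntegral.integral_const_mul]
  refine intervalIntegral.integral_congr fun s _ => ?_
  rw [tsum_planeHermite_boost_neg_one_div _ hτ, Circle.smul_def, smul_eq_mul]
  ring

end PlaneTheta

section Theta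

open MvPolynomial
open scoped FourierTransform

/-! ### Theta series of several planes -/

variable {m : ℕ}

lemma Q_eq_sum (x : Vec m) : Q x = ∑ j, Q₁ (x.comp j) := by
  rw [Q, Finset.mul_sum]
  rfl

lemma exp_B_eq_prod (x y : Vec m) :
    Complex.exp (2 * (Real.pi : ℂ) * Complex.I * (B x y : ℂ)) =
      ∏ j, (𝐞 (B₁ (x.comp j) (y.comp j)) : ℂ) := by
  have hB : B x y = ∑ j, B₁ (x.comp j) (y.comp j) := rfl
  simp only [Real.fourierChar_apply]
  rw [← Complex.exp_sum, hB, ← Finset.sum_mul, ← Complex.ofReal_sum, ← Finset.mul_sum]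
  push_cast
  ring_nf

lemma summable_norm_prod_comp_shift {g : Fin m → (Fin 2 → ℝ) → ℂ} {a : Vec m}
    (hg : ∀ j, Summable fun l : Fin 2 → ℤ => ‖g j (a.comp j + latticePoint l)‖) :
    Summable fun n : Fin m × Fin 2 → ℤ => ‖∏ j, g j ((shift a n).comp j)‖ :=
  (summable_norm_prod hg).comp_injective (Equiv.curry (Fin m) (Fin 2) ℤ).injective

lemma tsum_prod_comp_shift {g : Fin m → (Fin 2 → ℝ) → ℂ} {a : Vec m}
    (hg : ∀ j, Summable fun l : Fin 2 → ℤ => ‖g j (a.comp j + latticePoint l)‖) :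
    ∑' n : Fin m × Fin 2 → ℤ, ∏ j, g j ((shift a n).comp j) =
      ∏ j, ∑' l : Fin 2 → ℤ, g j (a.comp j + latticePoint l) := by
  rw [← tsum_prod hg, ← (Equiv.curry (Fin m) (Fin 2) ℤ).tsum_eq]
  rfl

variable {c₀ c₁ : Fin m → Fin 2 → ℝ} {d : ℕ} {f : Poly m} {τ : ℂ}

lemma IsSpherical.thetaTerm_eq_sum_prod (hc₀ : ∀ j, c₀ j ∈ negCone) (hc₁ : ∀ j, c₁ j ∈ negCone)
    (hf : IsSpherical d f) (b : Vec m) (τ : ℂ) (x : Vec m) :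
    thetaTerm c₀ c₁ d f b τ x = ∑ α ∈ f.support, coeff α f *
      ∏ j, planeTerm (coneAngle (c₀ j)) (coneAngle (c₁ j)) (α (j, 0)) (α (j, 1)) (b.comp j) τ
        (x.comp j) := by
  have hQ : Complex.exp (2 * (Real.pi : ℂ) * Complex.I * τ * (Q x : ℂ)) =
      ∏ j, Complex.exp (2 * (Real.pi : ℂ) * Complex.I * τ * (Q₁ (x.comp j) : ℂ)) := by
    rw [← Complex.exp_sum, Q_eq_sum, Complex.ofReal_sum, Finset.mul_sum]
  rw [thetaTerm, hf.kernel_eq_sum_prod hc₀ hc₁, hQ, exp_B_eq_prod, Finset.sum_mul, Finset.sum_mul]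
  refine Finset.sum_congr rfl fun α _ => ?_
  have hsmul (j : Fin m) : (√τ.im • x).comp j = √τ.im • x.comp j := rfl
  simp only [planeTerm, Circle.smul_def, smul_eq_mul, Finset.prod_mul_distrib, hsmul]
  ring

theorem IsSpherical.summable_norm_thetaTerm (hc₀ : ∀ j, c₀ j ∈ negCone)
    (hc₁ : ∀ j, c₁ j ∈ negCone) (hf : IsSpherical d f) (a b : Vec m) (hτ : 0 < τ.im) :
    Summable fun n : Fin m × Fin 2 → ℤ => ‖thetaTerm c₀ c₁ d f b τ (shift a n)‖ := by
  simp only [hf.thetaTerm_eq_sum_prod hc₀ hc₁]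
  refine Summable.of_nonneg_of_le (fun _ => norm_nonneg _) (fun n => norm_sum_le _ _)
    (summable_sum fun α _ => ?_)
  simp only [norm_mul (coeff α f)]
  exact (summable_norm_prod_comp_shift fun j =>
    summable_norm_planeTerm _ _ _ _ (a.comp j) _ hτ).mul_left _

theorem IsSpherical.tsum_thetaTerm (hc₀ : ∀ j, c₀ j ∈ negCone) (hc₁ : ∀ j, c₁ j ∈ negCone)
    (hf : IsSpherical d f) (a b : Vec m) (hτ : 0 < τ.im) :
    ∑' n, thetaTerm c₀ c₁ d f b τ (shift a n) = ∑ α ∈ f.support, coeff α f *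
      ∏ j, planeTheta (coneAngle (c₀ j)) (coneAngle (c₁ j)) (α (j, 0)) (α (j, 1)) (a.comp j)
        (b.comp j) τ := by
  have hsum (α : Fin m × Fin 2 →₀ ℕ) (j : Fin m) := summable_norm_planeTerm (coneAngle (c₀ j))
    (coneAngle (c₁ j)) (α (j, 0)) (α (j, 1)) (a.comp j) (b.comp j) hτ
  simp only [hf.thetaTerm_eq_sum_prod hc₀ hc₁]
  rw [Summable.tsum_finsetSum fun α _ =>
    (summable_norm_prod_comp_shift (hsum α)).of_norm.mul_left _]
  refine Finset.sum_congr rfl fun α _ => ?_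
  rw [tsum_mul_left, tsum_prod_comp_shift (hsum α)]
  rfl

lemma rpow_neg_one_div_im (d : ℕ) (hτ : 0 < τ.im) :
    (-1 / τ).im ^ (-(d : ℝ) / 2) = τ.im ^ (-(d : ℝ) / 2) * ‖τ‖ ^ d := by
  rw [neg_one_div_im, Real.div_rpow hτ.le (by positivity), div_eq_mul_inv,
    ← Real.rpow_neg (by positivity), neg_div, neg_neg, ← Real.rpow_natCast_mul (norm_nonneg τ),
    Nat.cast_ofNat, mul_div_cancel₀ _ two_ne_zero, Real.rpow_natCast]

lemma norm_pow_mul_prod_phase (hτ : τ ≠ 0) (e : Fin m → ℕ) :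
    (‖τ‖ : ℂ) ^ (∑ j, e j) * ∏ j, (‖τ‖ * (-τ / ‖τ‖) ^ (e j + 1)) = (-τ) ^ (m + ∑ j, e j) := by
  have hnorm : (‖τ‖ : ℂ) ≠ 0 := Complex.ofReal_ne_zero.mpr (norm_ne_zero_iff.mpr hτ)
  have hexp : m + ∑ j, e j = ∑ j, (e j + 1) := by simp [Finset.sum_add_distrib, add_comm]
  rw [hexp, ← Finset.prod_pow_eq_pow_sum, ← Finset.prod_mul_distrib, ← Finset.prod_pow_eq_pow_sum]
  refine Finset.prod_congr rfl fun j _ => ?_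
  rw [← mul_assoc, ← pow_succ, ← mul_pow, mul_div_cancel₀ _ hnorm, pow_succ']

theorem IsSpherical.tsum_thetaTerm_neg_one_div (hc₀ : ∀ j, c₀ j ∈ negCone)
    (hc₁ : ∀ j, c₁ j ∈ negCone) (hf : IsSpherical d f) (a b : Vec m) (hτ : 0 < τ.im) :
    ‖τ‖ ^ d * ∑' n, thetaTerm c₀ c₁ d f b (-1 / τ) (shift a n) = (-τ) ^ (m + d) *
      Complex.exp (2 * (Real.pi : ℂ) * Complex.I * (B a b : ℂ)) *
        ∑' n, thetaTerm c₀ c₁ d f a τ (shift (-b) n) := by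
  rw [hf.tsum_thetaTerm hc₀ hc₁ a b (neg_one_div_im_pos hτ), hf.tsum_thetaTerm hc₀ hc₁ (-b) a hτ,
    exp_B_eq_prod, Finset.mul_sum, Finset.mul_sum]
  refine Finset.sum_congr rfl fun α hα => ?_
  have hneg (j : Fin m) : (-b).comp j = -b.comp j := rfl
  simp only [planeTheta_neg_one_div _ _ _ _ _ _ hτ, Finset.prod_mul_distrib, hneg,
    ← hf.sum_eq_of_mem_support hα, ← norm_pow_mul_prod_phase (ne_zero_of_im_pos hτ)]
  ring

end Theta

end IndefiniteTheta

end

theorem theorem5p5 {m d : ℕ} (c₀ c₁ : Fin m → Fin 2 → ℝ)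
    (hc₀ : ∀ j, c₀ j ∈ IndefiniteTheta.negCone) (hc₁ : ∀ j, c₁ j ∈ IndefiniteTheta.negCone)
    (f : IndefiniteTheta.Poly m) (hf : IndefiniteTheta.IsSpherical d f)
    (a b : IndefiniteTheta.Vec m) :
    (∀ τ : ℂ, 0 < τ.im → Summable fun n : Fin m × Fin 2 → ℤ =>
      ‖IndefiniteTheta.thetaTerm c₀ c₁ d f b τ (IndefiniteTheta.shift a n)‖) ∧
    (∀ τ : ℂ, 0 < τ.im →
      IndefiniteTheta.theta c₀ c₁ d f a b (-1 / τ) =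
        (-τ) ^ (m + d) *
          Complex.exp (2 * (Real.pi : ℂ) * Complex.I * (IndefiniteTheta.B a b : ℂ)) *
          IndefiniteTheta.theta c₀ c₁ d f (-b) a τ) := by
  refine ⟨fun τ hτ => hf.summable_norm_thetaTerm hc₀ hc₁ a b hτ, fun τ hτ => ?_⟩
  have htsum := hf.tsum_thetaTerm_neg_one_div hc₀ hc₁ a b hτ
  rw [IndefiniteTheta.theta, IndefiniteTheta.rpow_neg_one_div_im d hτ, Complex.ofReal_mul,
    Complex.ofReal_pow, mul_assoc, htsum, IndefiniteTheta.theta]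
  ring
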